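/- Let $K_F(w,z)=\dfrac{e^{wz}}{z\,\sinh(\pi z)}$ and let $\dfrac1{\sinh z}=\sum_{m\ge -1}a_m z^m$ be the Laurent series in $0<|z|<\pi$. For $\theta\in(-\frac\pi2,\frac\pi2)$, $0<\delta<\pi\cos\theta$ and $0<\varepsilon<\cos\theta$ put $$W^F_\theta=\{w\in\mathbb C:\ -\pi\cos\theta+\delta<\Re(w)\cos\theta-\Im(w)\sin\theta<\pi\cos\theta-\delta\},\qquad h_m(w)=\int_{e^{i\theta}(\mathbb R+i\varepsilon)}K_F(w,z)\,z^m\,dz .$$ The asymptotic series of $4\log S_\gamma(w)=\int_{e^{i\theta}(\mathbb R+i\varepsilon)} K_F(w,z)\frac{dz}{\sinh(\gamma z)}$ as $\gamma\to0$, where $S_\gamma$ is Faddeev's quantum dilogarithm, is the formal series $\sum_{m\ge-1}a_m h_m(w)\gamma^m$. Let $g^+_\gamma(w)=\sum_{m\ge1}a_m h_m(w)\gamma^m$ be its part with positive powers of $\gamma$, and let $B_w=\mathcal B(g^+_\gamma(w))$ be its Borel transform, i.e. (the analytic continuation of) the sum of $\sum_{m\ge1}a_m h_m(w)\frac{\xi^{m-1}}{(m-1)!}$.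 For $w\in\mathbb C$ let $$P_w=\pm i\pi\,\mathbb Z_+(\pi-w+2\pi\mathbb Z)=\{\pm i\pi n(\pi-w+2\pi k):\ n\ge1,\ k\in\mathbb Z\}.$$ (1) Let $\theta,\delta,\varepsilon$ be as above and $w\in W^F_\theta$. The integrals $h_m(w)$, $m\ge1$, converge absolutely, and the half line $e^{-i\theta}[0,\infty)$ does not meet $P_w$. Let $V_{w,\theta}\subset\mathbb C\setminus P_w$ be any connected open set that contains this half line. Then the Borel transform of $g^+_\gamma(w)$ converges near $0$, its sum continues to a holomorphic function $B_w$ on $V_{w,\theta}$, and for all $\xi\in V_{w,\theta}$ $$B_w(\xi)=\frac2{i\pi^2}\sum_{n=1}^\infty\frac{(-1)^n}{n^2}\left(\frac1{1+e^{-i(w+i\frac{\xi}{\pi n})}}+\frac1{1+e^{-i(w-i\frac{\xi}{\pi n})}}\right),$$ where the series converges absolutely. (2) For every $w\in\mathbb C\setminus(\pi+2\pi\mathbb Z)$ the series in (1) converges absolutely for every $\xi\in\mathbb C\setminus P_w$, and its sum, including the factor $\frac{2}{i\pi^2}$, is holomorphic on $\mathbb C\setminus P_w$ and extends to a meromorphic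 function on $\mathbb C$. If $w\in W^F_\theta$ for some $\theta$ and $\delta$ as above, this function is the continuation of $B_w$. Its poles are exactly the points $\xi\in P_w$ for which $$\sum_{\substack{n\ge1,\,k\in\mathbb Z\\ i\pi n(\pi-w+2\pi k)=\xi}}\frac{(-1)^n}{n}\ \neq\sum_{\substack{n\ge1,\,k\in\mathbb Z\\ -i\pi n(\pi-w+2\pi k)=\xi}}\frac{(-1)^n}{n}$$ (both sums are finite). In particular, if $w\notin\pi\mathbb Q$, the set of poles is exactly $P_w$. -/

import Mathlib

open Complex MeasureTheory Set Filter Topology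

noncomputable section

namespace Faddeev

/-- The kernel `K_F(w, z) = e^{wz} / (sinh(πz) z)`. -/
def kernel (w z : ℂ) : ℂ := exp (w * z) / (sinh ((Real.pi : ℂ) * z) * z)

/-- The function `f_F(z) = 1 / sinh z`. -/
def f (z : ℂ) : ℂ := 1 / sinh z

/-- Coefficient of `z ^ m` in the Laurent series of `f_F` in `0 < |z| < π`,
as a Cauchy integral over the unit circle. -/
def laurentCoeff (m : ℤ) : ℂ :=
  (2 * (Real.pi : ℂ) * I)⁻¹ * ∮ z in C(0, 1), f z * z ^ (-m - 1)

/-- Parametrization of the rotated line `e^{iθ}(ℝ + iε)`. -/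
def contour (θ ε t : ℝ) : ℂ := exp (θ * I) * ((t : ℂ) + ε * I)

/-- The integrand of `h_m(w)`, pulled back to `ℝ` (the derivative of the contour is `e^{iθ}`). -/
def hIntegrand (θ ε : ℝ) (w : ℂ) (m : ℤ) (t : ℝ) : ℂ :=
  kernel w (contour θ ε t) * contour θ ε t ^ m * exp (θ * I)

/-- `h_m(w) = ∫_{e^{iθ}(ℝ + iε)} K_F(w, z) z ^ m dz`. -/
def h (θ ε : ℝ) (m : ℤ) (w : ℂ) : ℂ := ∫ t : ℝ, hIntegrand θ ε w m t

/-- The part `g⁺ = ∑_{m ≥ 1} a_m h_m(w) γ ^ m` of the formal asymptotic series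
`∑_{m ≥ -1} a_m h_m(w) γ ^ m` that has positive powers of `γ`. -/
def gPlus (θ ε : ℝ) (w : ℂ) : PowerSeries ℂ :=
  PowerSeries.mk fun m : ℕ => if m = 0 then 0 else laurentCoeff m * h θ ε m w

/-- The formal Borel transform on power series without constant term:
`γ ^ m ↦ ξ ^ (m - 1) / (m - 1)!` for `m ≥ 1`, extended linearly. -/
def borel (g : PowerSeries ℂ) : PowerSeries ℂ :=
  PowerSeries.mk fun m : ℕ => PowerSeries.coeff (m + 1) g / (m.factorial : ℂ)

/-- `B` is a holomorphic function on `V` whose germ at `0` is the sum of the convergent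
Borel transform of `g⁺`. -/
def IsBorelTransformOn (θ ε : ℝ) (w : ℂ) (V : Set ℂ) (B : ℂ → ℂ) : Prop :=
  AnalyticOnNhd ℂ B V ∧
    ∀ᶠ ξ in 𝓝 (0 : ℂ),
      HasSum (fun m : ℕ => PowerSeries.coeff m (borel (gPlus θ ε w)) * ξ ^ m) (B ξ)

/-- The strip `W_θ^F` with parameter `δ`. -/
def W (θ δ : ℝ) : Set ℂ :=
  {w | -(Real.pi * Real.cos θ) + δ < w.re * Real.cos θ - w.im * Real.sin θ ∧
    w.re * Real.cos θ - w.im * Real.sin θ < Real.pi * Real.cos θ - δ}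

/-- The closed half line `e^{iα} [0, ∞)`. -/
def halfLine (α : ℝ) : Set ℂ := {ξ | ∃ s : ℝ, 0 ≤ s ∧ ξ = s * exp (α * I)}

/-- The point `iπn(π - w + 2πk)`. -/
def polePoint (w : ℂ) (n : ℕ) (k : ℤ) : ℂ :=
  I * Real.pi * n * (Real.pi - w + 2 * Real.pi * k)

/-- The set `±iπ ℤ_+ (π - w + 2πℤ)`. -/
def poleSet (w : ℂ) : Set ℂ :=
  {ξ | ∃ n : ℕ, 1 ≤ n ∧ ∃ k : ℤ, ξ = polePoint w n k ∨ ξ = -polePoint w n k}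

/-- The difference of the sums of `(-1)^n / n` over the representations `ξ = iπn(π - w + 2πk)`
and over the representations `ξ = -iπn(π - w + 2πk)`, with `n ≥ 1` and `k ∈ ℤ`; both are finite
sums when `w ∉ π + 2πℤ`. -/
def poleWeight (w ξ : ℂ) : ℝ :=
  (∑ᶠ p ∈ {p : ℕ × ℤ | 1 ≤ p.1 ∧ ξ = polePoint w p.1 p.2}, (-1 : ℝ) ^ p.1 / (p.1 : ℝ)) -
    ∑ᶠ p ∈ {p : ℕ × ℤ | 1 ≤ p.1 ∧ ξ = -polePoint w p.1 p.2}, (-1 : ℝ) ^ p.1 / (p.1 : ℝ)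

/-- The `n`-th summand, `n ≥ 1`, of the series for `B_w(ξ)`. -/
def term (w ξ : ℂ) (n : ℕ) : ℂ :=
  (-1) ^ n / (n : ℂ) ^ 2 *
    (1 / (1 + exp (-I * (w + I * (ξ / (Real.pi * n))))) +
      1 / (1 + exp (-I * (w - I * (ξ / (Real.pi * n))))))

end Faddeev

end

/-!
The substitution `z ↦ z + i` multiplies `e^{wz} / sinh(πz)` by `-e^{iw}` and moves the contour
across the single simple pole `z = i`. Hence its integral over the contour is
`G(w) = (2 / i) / (1 + e^{-iw})` (`integral_expSinh_contour`), a meromorphic function of `w` with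
poles `π + 2πℤ`; the moments `h_{m+1}(w)` are the derivatives `G^{(m)}(w)` (`hasSum_h_mul_pow`).

On the other hand the partial fractions `1 / sinh z = 1 / z + ∑ 2 (-1)^n z / (z² + π²n²)` give
`a_{m+1} = ∑_n (-1)^n / (πn)² * ((i / πn)^m + (-i / πn)^m)` (`hasSum_laurentCoeff`). Inserting this
into the Borel transform `∑_m a_{m+1} h_{m+1}(w) ξ^m / m!` and summing over `m` first turns each
partial fraction into the two Taylor series of `G` at `w` evaluated at `±iξ / πn`, which is the
series of the theorem (`hasSum_borel_gPlus`).

For the continuation, only finitely many summands can have a pole in a given disc: for large `n` the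
arguments `w ± iξ / πn` stay in a neighbourhood of `w` on which `G` is bounded, so the remaining
summands form a normally convergent series of holomorphic functions (`exists_borelSum_eq`). The
residue at `ξ` of the finite part is a nonzero multiple of `poleWeight w ξ`
(`hasSimplePart_borelSum`), and the poles are simple, so they are the points of nonzero weight. If
`w / π` is irrational, then each point of `poleSet w` is represented only once and its weight is
`±1 / n`.
-/

noncomputable section

namespace Faddeev

/-! ### Decay of the integrand along the contour -/

/-- The integrand `e^{wz} / sinh(πz)`, i.e. the kernel times `z`. -/
def expSinh (w z : ℂ) : ℂ := exp (w * z) / sinh ((Real.pi : ℂ) * z)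

lemma exp_div_four_le_norm_sinh {z : ℂ} (hz : 1 ≤ |z.re|) :
    Real.exp |z.re| / 4 ≤ ‖sinh z‖ := by
  have key : ∀ u : ℂ, 1 ≤ u.re → Real.exp u.re / 4 ≤ ‖sinh u‖ := by
    intro u hu
    have h1 : sinh u = (exp u - exp (-u)) / 2 := rfl
    have h2 := norm_sub_norm_le (exp u) (exp (-u))
    rw [Complex.norm_exp, Complex.norm_exp, neg_re] at h2
    have h3 : Real.exp (-u.re) ≤ 1 := Real.exp_le_one_iff.2 (by linarith)
    have h4 := Real.add_one_le_exp u.re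
    rw [h1, norm_div]
    simp only [RCLike.norm_ofNat]
    linarith
  rcases abs_cases z.re with ⟨h, _⟩ | ⟨h, _⟩
  · rw [h] at hz ⊢; exact key z hz
  · have := key (-z) (by simpa [h] using hz)
    rw [h]; simpa using this

lemma sinh_pi_mul_eq_zero_iff {z : ℂ} :
    sinh ((Real.pi : ℂ) * z) = 0 ↔ ∃ k : ℤ, z = k * I := by
  have h1 : sinh ((Real.pi : ℂ) * z) = 0 ↔ Complex.sin (Real.pi * z * I) = 0 := by
    rw [Complex.sin_mul_I]; simp
  rw [h1, Complex.sin_eq_zero_iff]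
  have hpi : (Real.pi : ℂ) ≠ 0 := by exact_mod_cast Real.pi_ne_zero
  constructor
  · rintro ⟨k, hk⟩
    refine ⟨-k, ?_⟩
    have : z * I = k := by
      apply mul_left_cancel₀ hpi; linear_combination hk
    push_cast
    linear_combination (-I) * this + z * I_mul_I
  · rintro ⟨k, rfl⟩
    refine ⟨-k, ?_⟩
    push_cast
    linear_combination (Real.pi * k : ℂ) * I_mul_I

lemma re_rot_mul (θ : ℝ) (t y : ℝ) :
    (exp (θ * I) * ((t : ℂ) + y * I)).re = t * Real.cos θ - y * Real.sin θ := by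
  simp [exp_ofReal_mul_I_re, exp_ofReal_mul_I_im]; ring

lemma im_rot_mul (θ : ℝ) (t y : ℝ) :
    (exp (θ * I) * ((t : ℂ) + y * I)).im = t * Real.sin θ + y * Real.cos θ := by
  simp [exp_ofReal_mul_I_re, exp_ofReal_mul_I_im]; ring

/-- In the rotated coordinate `ζ = t + iy`, the zeros of `sinh(πz)`, `z = e^{iθ}ζ`, lie at the
heights `y = k cos θ`. -/
lemma im_eq_of_sinh_eq_zero {θ t y : ℝ}
    (h : sinh ((Real.pi : ℂ) * (exp (θ * I) * ((t : ℂ) + y * I))) = 0) :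
    ∃ k : ℤ, y = k * Real.cos θ ∧ t = k * Real.sin θ := by
  obtain ⟨k, hk⟩ := sinh_pi_mul_eq_zero_iff.1 h
  have h1 := re_rot_mul θ t y
  have h2 := im_rot_mul θ t y
  rw [hk] at h1 h2
  simp at h1 h2
  refine ⟨k, ?_, ?_⟩
  · linear_combination (-y) * Real.sin_sq_add_cos_sq θ + Real.sin θ * h1 - Real.cos θ * h2
  · linear_combination (-t) * Real.sin_sq_add_cos_sq θ - Real.cos θ * h1 - Real.sin θ * h2

lemma contour_sinh_ne_zero {θ ε : ℝ} (hε : ε ∈ Ioo 0 (Real.cos θ)) (t : ℝ) :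
    sinh ((Real.pi : ℂ) * contour θ ε t) ≠ 0 := by
  intro h
  obtain ⟨k, hk, -⟩ := im_eq_of_sinh_eq_zero h
  have hc : 0 < Real.cos θ := hε.1.trans hε.2
  have h0 : (0 : ℝ) < k := by
    by_contra hcon; push Not at hcon
    have := mul_nonpos_of_nonpos_of_nonneg hcon hc.le
    linarith [hε.1]
  have h1 : (k : ℝ) < 1 := by
    by_contra hcon; push Not at hcon
    nlinarith [hε.2]
  have h0' : 0 < k := by exact_mod_cast h0
  have h1' : k < 1 := by exact_mod_cast h1
  omega

lemma contour_ne_zero {θ ε : ℝ} (hε : ε ∈ Ioo 0 (Real.cos θ)) (t : ℝ) : contour θ ε t ≠ 0 := by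
  intro h
  exact contour_sinh_ne_zero hε t (by rw [h]; simp)

lemma norm_contour_le {θ ε : ℝ} (hε : 0 < ε) (t : ℝ) : ‖contour θ ε t‖ ≤ |t| + ε := by
  rw [contour, norm_mul, norm_exp_ofReal_mul_I, one_mul]
  refine (norm_add_le _ _).trans ?_
  simp [abs_of_pos hε]

lemma continuous_contour (θ ε : ℝ) : Continuous (contour θ ε) := by
  unfold contour; fun_prop

lemma continuous_expSinh_contour {θ ε : ℝ} (hε : ε ∈ Ioo 0 (Real.cos θ)) (w : ℂ) :
    Continuous fun t => expSinh w (contour θ ε t) := by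
  have := continuous_contour θ ε
  unfold expSinh
  exact Continuous.div (by fun_prop) (by fun_prop) (contour_sinh_ne_zero hε)

/-- Membership in the strip bounds the exponential rate of `e^{wz}` along the rotated line. -/
lemma abs_re_mul_rot_le {θ δ : ℝ} {w : ℂ} (hw : w ∈ W θ δ) :
    |w.re * Real.cos θ - w.im * Real.sin θ| ≤ Real.pi * Real.cos θ - δ := by
  obtain ⟨h1, h2⟩ := hw
  rw [abs_le]; constructor <;> linarith

/-- Exponential decay of the integrand at both ends of the rotated strip. -/
lemma norm_expSinh_le {θ δ : ℝ} (hc : 0 < Real.cos θ) {w : ℂ} (hw : w ∈ W θ δ) {t y : ℝ}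
    (ht : 1 ≤ Real.pi * (|t| * Real.cos θ - |y|)) :
    ‖expSinh w (exp (θ * I) * ((t : ℂ) + y * I))‖ ≤
      4 * Real.exp ((‖w‖ + Real.pi) * |y|) * Real.exp (-δ * |t|) := by
  set z := exp (θ * I) * ((t : ℂ) + y * I) with hz
  have hre : z.re = t * Real.cos θ - y * Real.sin θ := re_rot_mul θ t y
  have hlow : |t| * Real.cos θ - |y| ≤ |z.re| := by
    rw [hre]
    have h1 := abs_sub_abs_le_abs_sub (t * Real.cos θ) (y * Real.sin θ)
    rw [abs_mul, abs_mul, abs_of_pos hc] at h1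
    have h2 : |y| * |Real.sin θ| ≤ |y| * 1 :=
      mul_le_mul_of_nonneg_left (Real.abs_sin_le_one θ) (abs_nonneg y)
    linarith
  have hpre : ((Real.pi : ℂ) * z).re = Real.pi * z.re := by simp
  have habs : |((Real.pi : ℂ) * z).re| = Real.pi * |z.re| := by
    rw [hpre, abs_mul, abs_of_pos Real.pi_pos]
  have hlow' := mul_le_mul_of_nonneg_left hlow Real.pi_pos.le
  have hs := exp_div_four_le_norm_sinh (z := (Real.pi : ℂ) * z) (by rw [habs]; linarith)
  rw [habs] at hs
  have hnum : (w * z).re ≤ (Real.pi * Real.cos θ - δ) * |t| + ‖w‖ * |y| := by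
    have e1 : w * z = (w * exp (θ * I)) * t + (w * exp (θ * I)) * (y * I) := by rw [hz]; ring
    have e2 : ((w * exp (θ * I)) * t).re ≤ (Real.pi * Real.cos θ - δ) * |t| := by
      have : ((w * exp (θ * I)) * t).re = (w.re * Real.cos θ - w.im * Real.sin θ) * t := by
        rw [mul_re, mul_re]; simp [exp_ofReal_mul_I_re, exp_ofReal_mul_I_im]
      rw [this]
      refine (le_abs_self _).trans ?_
      rw [abs_mul]
      exact mul_le_mul_of_nonneg_right (abs_re_mul_rot_le hw) (abs_nonneg t)
    have e3 : ((w * exp (θ * I)) * (y * I)).re ≤ ‖w‖ * |y| := by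
      refine (re_le_norm _).trans ?_
      simp [norm_exp_ofReal_mul_I]
    rw [e1, add_re]; linarith
  rw [expSinh, norm_div, Complex.norm_exp]
  have hpos : 0 < ‖sinh ((Real.pi : ℂ) * z)‖ := lt_of_lt_of_le (by positivity) hs
  rw [div_le_iff₀ hpos]
  calc Real.exp (w * z).re
      ≤ Real.exp ((‖w‖ + Real.pi) * |y| + -δ * |t| + Real.pi * |z.re|) :=
        Real.exp_le_exp.2 (by nlinarith)
    _ = 4 * Real.exp ((‖w‖ + Real.pi) * |y|) * Real.exp (-δ * |t|) *
          (Real.exp (Real.pi * |z.re|) / 4) := by rw [Real.exp_add, Real.exp_add]; ring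
    _ ≤ _ := mul_le_mul_of_nonneg_left hs (by positivity)

lemma integrable_exp_neg_mul_abs {b : ℝ} (hb : 0 < b) :
    Integrable fun t : ℝ => Real.exp (-b * |t|) := by
  rw [← integrableOn_univ, ← Set.Iic_union_Ioi (a := (0 : ℝ))]
  refine IntegrableOn.union ?_ ?_
  · refine (integrableOn_exp_mul_Iic hb 0).congr_fun (fun t ht => ?_) measurableSet_Iic
    simp only [abs_of_nonpos (mem_Iic.1 ht)]; ring_nf
  · refine (integrableOn_exp_mul_Ioi (neg_lt_zero.2 hb) 0).congr_fun (fun t ht => ?_)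
      measurableSet_Ioi
    simp only [abs_of_pos (mem_Ioi.1 ht)]

/-- The dominating function for all the integrals over the contour: the integrand stays integrable
after multiplication by `e^{r|z|}` with `r < δ`. -/
lemma integrable_norm_expSinh_mul_exp {θ δ ε r : ℝ} (hε : ε ∈ Ioo 0 (Real.cos θ))
    (hr0 : 0 ≤ r) (hr : r < δ) {w : ℂ} (hw : w ∈ W θ δ) :
    Integrable fun t : ℝ => ‖expSinh w (contour θ ε t)‖ * Real.exp (r * ‖contour θ ε t‖) := by
  have hc : 0 < Real.cos θ := hε.1.trans hε.2
  have hcont : Continuous fun t : ℝ =>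
      ‖expSinh w (contour θ ε t)‖ * Real.exp (r * ‖contour θ ε t‖) := by
    have h1 := continuous_expSinh_contour hε w
    have h2 := continuous_contour θ ε
    fun_prop
  refine hcont.locallyIntegrable.integrable_of_isBigO_cocompact
    (g := fun t : ℝ => Real.exp (-(δ - r) * |t|)) ?_
    ((integrable_exp_neg_mul_abs (sub_pos.2 hr)).integrableAtFilter _)
  refine Asymptotics.IsBigO.of_bound
    (4 * Real.exp ((‖w‖ + Real.pi) * |ε|) * Real.exp (r * ε)) ?_
  have hev : ∀ᶠ t : ℝ in cocompact ℝ, (1 / Real.pi + |ε|) / Real.cos θ ≤ ‖t‖ :=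
    tendsto_norm_cocompact_atTop.eventually_ge_atTop _
  filter_upwards [hev] with t ht
  rw [div_le_iff₀ hc, Real.norm_eq_abs] at ht
  have ht' : 1 ≤ Real.pi * (|t| * Real.cos θ - |ε|) := by
    have := mul_le_mul_of_nonneg_left ht Real.pi_pos.le
    have e : Real.pi * (1 / Real.pi + |ε|) = 1 + Real.pi * |ε| := by
      field_simp
    rw [e] at this; linarith
  have hb := norm_expSinh_le hc hw ht'
  have hn : Real.exp (r * ‖contour θ ε t‖) ≤ Real.exp (r * ε) * Real.exp (r * |t|) := by
    rw [← Real.exp_add]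
    refine Real.exp_le_exp.2 ?_
    have := mul_le_mul_of_nonneg_left (norm_contour_le (θ := θ) hε.1 t) hr0
    linarith
  rw [Real.norm_of_nonneg (by positivity), Real.norm_of_nonneg (Real.exp_pos _).le]
  calc _ ≤ (4 * Real.exp ((‖w‖ + Real.pi) * |ε|) * Real.exp (-δ * |t|)) *
        (Real.exp (r * ε) * Real.exp (r * |t|)) :=
        mul_le_mul hb hn (Real.exp_pos _).le (by positivity)
    _ = 4 * Real.exp ((‖w‖ + Real.pi) * |ε|) * Real.exp (r * ε) *
          (Real.exp (-δ * |t|) * Real.exp (r * |t|)) := by ring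
    _ = _ := by rw [← Real.exp_add]; ring_nf

/-! ### The moments `h_m` -/

lemma hIntegrand_succ {θ ε : ℝ} (hε : ε ∈ Ioo 0 (Real.cos θ)) (w : ℂ) (m : ℕ) (t : ℝ) :
    hIntegrand θ ε w ((m + 1 : ℕ) : ℤ) t =
      expSinh w (contour θ ε t) * contour θ ε t ^ m * exp (θ * I) := by
  have h0 := contour_ne_zero hε t
  have h1 := contour_sinh_ne_zero hε t
  rw [hIntegrand, kernel, expSinh, zpow_natCast, pow_succ]
  field_simp

lemma continuous_hIntegrand_succ {θ ε : ℝ} (hε : ε ∈ Ioo 0 (Real.cos θ)) (w : ℂ) (m : ℕ) :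
    Continuous (hIntegrand θ ε w ((m + 1 : ℕ) : ℤ)) := by
  have h1 := continuous_expSinh_contour hε w
  have h2 := continuous_contour θ ε
  rw [funext (hIntegrand_succ hε w m)]
  fun_prop

lemma integrable_hIntegrand {θ δ ε : ℝ} (hδ : 0 < δ) (hε : ε ∈ Ioo 0 (Real.cos θ)) {w : ℂ}
    (hw : w ∈ W θ δ) {m : ℕ} (hm : 1 ≤ m) : Integrable (hIntegrand θ ε w m) := by
  obtain ⟨m, rfl⟩ := Nat.exists_eq_add_of_le' hm
  set r := δ / 2 with hr
  have hr0 : 0 < r := by positivity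
  refine ((integrable_norm_expSinh_mul_exp hε hr0.le (by linarith) hw).const_mul
    ((m.factorial : ℝ) / r ^ m)).mono' (continuous_hIntegrand_succ hε w m).aestronglyMeasurable
    (Eventually.of_forall fun t => ?_)
  rw [hIntegrand_succ hε, norm_mul, norm_mul, norm_exp_ofReal_mul_I, mul_one, norm_pow]
  set x := ‖contour θ ε t‖
  have hx : 0 ≤ x := norm_nonneg _
  have h := Real.pow_div_factorial_le_exp (r * x) (by positivity) m
  have h' : x ^ m ≤ (m.factorial : ℝ) / r ^ m * Real.exp (r * x) := by
    rw [div_mul_eq_mul_div, le_div_iff₀ (by positivity)]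
    rw [div_le_iff₀ (by positivity), mul_pow] at h
    linarith
  calc _ ≤ ‖expSinh w (contour θ ε t)‖ * ((m.factorial : ℝ) / r ^ m * Real.exp (r * x)) :=
        mul_le_mul_of_nonneg_left h' (norm_nonneg _)
    _ = _ := by ring

lemma hasSum_exp_div_factorial (z : ℂ) :
    HasSum (fun m : ℕ => z ^ m / (m.factorial : ℂ)) (exp z) := by
  rw [Complex.exp_eq_exp_ℂ]
  exact NormedSpace.expSeries_div_hasSum_exp z

/-- Differentiating under the integral sign in closed form: the moments `h_{m+1}(w)` are the Taylor
coefficients at `w` of the function `w ↦ ∫ e^{wz} / sinh(πz) dz`. -/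
lemma hasSum_h_mul_pow {θ δ ε : ℝ} (hε : ε ∈ Ioo 0 (Real.cos θ)) {w : ℂ}
    (hw : w ∈ W θ δ) {x : ℂ} (hx : ‖x‖ < δ) :
    HasSum (fun m : ℕ => h θ ε ((m + 1 : ℕ) : ℤ) w * (x ^ m / m.factorial))
      (∫ t : ℝ, expSinh (w + x) (contour θ ε t) * exp (θ * I)) := by
  have hexp : ∀ t : ℝ, HasSum (fun m : ℕ => ‖expSinh w (contour θ ε t)‖ *
      ((‖x‖ * ‖contour θ ε t‖) ^ m / m.factorial))
      (‖expSinh w (contour θ ε t)‖ * Real.exp (‖x‖ * ‖contour θ ε t‖)) := fun t => by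
    have h1 : HasSum (fun m : ℕ => (‖x‖ * ‖contour θ ε t‖) ^ m / (m.factorial : ℝ))
        (Real.exp (‖x‖ * ‖contour θ ε t‖)) := by
      rw [Real.exp_eq_exp_ℝ]
      exact NormedSpace.expSeries_div_hasSum_exp _
    exact h1.mul_left _
  have key := hasSum_integral_of_dominated_convergence (μ := volume)
    (F := fun (m : ℕ) (t : ℝ) => hIntegrand θ ε w ((m + 1 : ℕ) : ℤ) t * (x ^ m / m.factorial))
    (f := fun t : ℝ => expSinh (w + x) (contour θ ε t) * exp (θ * I))
    (fun m t => ‖expSinh w (contour θ ε t)‖ * ((‖x‖ * ‖contour θ ε t‖) ^ m / m.factorial))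
    (fun m => ((continuous_hIntegrand_succ hε w m).mul continuous_const).aestronglyMeasurable)
    (fun m => Eventually.of_forall fun t => by
      rw [hIntegrand_succ hε]
      simp only [norm_mul, norm_div, norm_pow, norm_exp_ofReal_mul_I, mul_one, mul_pow,
        RCLike.norm_natCast]
      apply le_of_eq; ring)
    (Eventually.of_forall fun t => (hexp t).summable)
    (by
      simp_rw [fun t => (hexp t).tsum_eq]
      exact integrable_norm_expSinh_mul_exp hε (norm_nonneg x) hx hw)
    (Eventually.of_forall fun t => by
      have h2 := (hasSum_exp_div_factorial (x * contour θ ε t)).mul_left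
        (expSinh w (contour θ ε t) * exp (θ * I))
      have e : expSinh w (contour θ ε t) * exp (θ * I) * exp (x * contour θ ε t) =
          expSinh (w + x) (contour θ ε t) * exp (θ * I) := by
        rw [expSinh, expSinh, add_mul, exp_add]; ring
      rw [e] at h2
      refine h2.congr_fun fun m => ?_
      rw [hIntegrand_succ hε, mul_pow]; ring)
  refine key.congr_fun fun m => ?_
  rw [Faddeev.h, integral_mul_const]

/-! ### A residue theorem for a strip -/

lemma ofReal_add_mul_I_ne_zero {c : ℝ} (hc : c ≠ 0) (t : ℝ) : (t : ℂ) + c * I ≠ 0 := by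
  intro h
  apply hc
  simpa using congrArg Complex.im h

lemma continuous_inv_ofReal_add_mul_I {c : ℝ} (hc : c ≠ 0) :
    Continuous fun t : ℝ => ((t : ℂ) + c * I)⁻¹ :=
  Continuous.inv₀ (by fun_prop) (ofReal_add_mul_I_ne_zero hc)

/-- The odd part of `1 / (t + ic)` cancels on a symmetric interval; the even part is the derivative
of an arctangent. -/
lemma integral_inv_ofReal_add_mul_I {c : ℝ} (hc : c ≠ 0) (R : ℝ) :
    ∫ t in (-R)..R, ((t : ℂ) + c * I)⁻¹ = -(2 * Real.arctan (R / c) : ℝ) * I := by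
  have hcont := continuous_inv_ofReal_add_mul_I hc
  have hcont' := continuous_inv_ofReal_add_mul_I (neg_ne_zero.2 hc)
  have h1 : ∫ t in (-R)..R, ((t : ℂ) + c * I)⁻¹ =
      ∫ t in (-R)..R, -((t : ℂ) + (-c : ℝ) * I)⁻¹ := by
    rw [← neg_neg R, ← intervalIntegral.integral_comp_neg, neg_neg]
    congr 1
    ext t
    rw [← inv_neg]; congr 1; push_cast; ring
  have h2 : ∀ t : ℝ, ((t : ℂ) + c * I)⁻¹ + -((t : ℂ) + (-c : ℝ) * I)⁻¹ =
      ((-(2 * (1 / (1 + (t / c) ^ 2) * (1 / c))) : ℝ) : ℂ) * I := by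
    intro t
    have e1 := ofReal_add_mul_I_ne_zero hc t
    have e2 := ofReal_add_mul_I_ne_zero (neg_ne_zero.2 hc) t
    have hc' : (c : ℂ) ≠ 0 := by exact_mod_cast hc
    have e3 : (1 + (t / c) ^ 2 : ℂ) ≠ 0 := by
      have : (1 + (t / c) ^ 2 : ℝ) ≠ 0 := by positivity
      exact_mod_cast this
    have e4 : ((t : ℂ) + c * I) * ((t : ℂ) + (-c : ℝ) * I) = c ^ 2 * (1 + (t / c) ^ 2) := by
      push_cast; field_simp
      linear_combination (-(c : ℂ) ^ 2) * I_sq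
    have e5 : ((t : ℂ) + c * I)⁻¹ + -((t : ℂ) + (-c : ℝ) * I)⁻¹ =
        (-(2 * c * I)) / (((t : ℂ) + c * I) * ((t : ℂ) + (-c : ℝ) * I)) := by
      rw [eq_div_iff (mul_ne_zero e1 e2), add_mul]
      rw [inv_mul_cancel_left₀ e1]
      rw [show -((t : ℂ) + (-c : ℝ) * I)⁻¹ * (((t : ℂ) + c * I) * ((t : ℂ) + (-c : ℝ) * I)) =
        -(((t : ℂ) + (-c : ℝ) * I)⁻¹ * ((t : ℂ) + (-c : ℝ) * I) * ((t : ℂ) + c * I)) by ring,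
        inv_mul_cancel₀ e2]
      push_cast; ring
    rw [e5, e4]
    push_cast
    field_simp
  have h3 : ∀ t : ℝ, HasDerivAt (fun t : ℝ => Real.arctan (t / c))
      (1 / (1 + (t / c) ^ 2) * (1 / c)) t := fun t =>
    ((hasDerivAt_id t).div_const c).arctan
  have h4 : ∫ t in (-R)..R, (1 / (1 + (t / c) ^ 2) * (1 / c) : ℝ) =
      Real.arctan (R / c) - Real.arctan (-R / c) := by
    refine intervalIntegral.integral_eq_sub_of_hasDerivAt (fun t _ => h3 t) ?_
    refine Continuous.intervalIntegrable ?_ _ _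
    refine Continuous.mul (Continuous.div continuous_const (by fun_prop) fun t => ?_)
      continuous_const
    positivity
  have h5 : 2 * ∫ t in (-R)..R, ((t : ℂ) + c * I)⁻¹ =
      ((-(2 * (Real.arctan (R / c) - Real.arctan (-R / c))) : ℝ) : ℂ) * I := by
    rw [two_mul]
    nth_rewrite 2 [h1]
    have hneg : Continuous fun t : ℝ => -((t : ℂ) + (-c : ℝ) * I)⁻¹ := hcont'.neg
    rw [← intervalIntegral.integral_add (hcont.intervalIntegrable _ _)
      (hneg.intervalIntegrable _ _)]
    simp_rw [h2]
    rw [intervalIntegral.integral_mul_const, intervalIntegral.integral_ofReal,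
      intervalIntegral.integral_neg, intervalIntegral.integral_const_mul, h4]
  rw [neg_div, Real.arctan_neg] at h5
  apply mul_left_cancel₀ (two_ne_zero (α := ℂ))
  rw [h5]; push_cast; ring

lemma tendsto_integral_inv_of_pos {c : ℝ} (hc : 0 < c) :
    Tendsto (fun R : ℝ => ∫ t in (-R)..R, ((t : ℂ) + c * I)⁻¹) atTop (𝓝 (-Real.pi * I)) := by
  simp_rw [integral_inv_ofReal_add_mul_I hc.ne']
  have h1 : Tendsto (fun R : ℝ => Real.arctan (R / c)) atTop (𝓝 (Real.pi / 2)) :=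
    (tendsto_nhds_of_tendsto_nhdsWithin Real.tendsto_arctan_atTop).comp
      (tendsto_id.atTop_div_const hc)
  have h2 : Tendsto (fun R : ℝ => -((2 * Real.arctan (R / c) : ℝ) : ℂ) * I) atTop
      (𝓝 (-((2 * (Real.pi / 2) : ℝ) : ℂ) * I)) :=
    ((continuous_ofReal.tendsto _).comp (h1.const_mul 2)).neg.mul_const I
  rwa [mul_div_cancel₀ _ (two_ne_zero' ℝ)] at h2

lemma tendsto_integral_inv_of_neg {c : ℝ} (hc : c < 0) :
    Tendsto (fun R : ℝ => ∫ t in (-R)..R, ((t : ℂ) + c * I)⁻¹) atTop (𝓝 (Real.pi * I)) := by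
  have h := (tendsto_integral_inv_of_pos (neg_pos.2 hc)).neg
  simp_rw [integral_inv_ofReal_add_mul_I (neg_pos.2 hc).ne', div_neg, Real.arctan_neg] at h
  simp_rw [integral_inv_ofReal_add_mul_I hc.ne]
  convert h using 2
  · push_cast; ring
  · ring

/-- The residue theorem for a horizontal strip with one simple pole `p` of residue `N p`: the part
`N p / (z - p)` is integrated explicitly, and what remains is the holomorphic function
`dslope N p`, to which Cauchy's theorem on growing rectangles applies. -/
theorem integral_sub_integral_of_simple_pole {N : ℂ → ℂ} {a b : ℝ} {p : ℂ}
    (hap : a < p.im) (hpb : p.im < b)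
    (hN : ∀ z : ℂ, z.im ∈ Icc a b → DifferentiableAt ℂ N z)
    (ha : Integrable fun x : ℝ => N (x + a * I) / (x + a * I - p))
    (hb : Integrable fun x : ℝ => N (x + b * I) / (x + b * I - p))
    (hdecay : ∀ η : ℝ, 0 < η → ∃ T : ℝ, ∀ x : ℝ, T ≤ |x| → ∀ y ∈ Icc a b,
      ‖N (x + y * I) / (x + y * I - p)‖ ≤ η) :
    (∫ x : ℝ, N (x + a * I) / (x + a * I - p)) - (∫ x : ℝ, N (x + b * I) / (x + b * I - p)) =
      2 * Real.pi * I * N p := by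
  set D := dslope N p with hD
  have hab : a ≤ b := (hap.trans hpb).le
  have hS : {z : ℂ | z.im ∈ Icc a b} ∈ 𝓝 p :=
    mem_of_superset ((isOpen_Ioo.preimage continuous_im).mem_nhds ⟨hap, hpb⟩)
      (preimage_mono Ioo_subset_Icc_self)
  have hDdiff : DifferentiableOn ℂ D {z : ℂ | z.im ∈ Icc a b} :=
    (differentiableOn_dslope hS).2 fun z hz => (hN z hz).differentiableWithinAt
  have hDeq : ∀ z : ℂ, z ≠ p → D z = N z / (z - p) - N p * (z - p)⁻¹ := by
    intro z hz
    rw [hD, dslope_of_ne _ hz, slope_def_field]; ring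
  -- on each horizontal line the polar part contributes `N p * L` in the limit
  have hline : ∀ c : ℝ, c ∈ Icc a b → c ≠ p.im → ∀ L : ℂ,
      Tendsto (fun R : ℝ => ∫ t in (-R)..R, ((t : ℂ) + (c - p.im : ℝ) * I)⁻¹) atTop (𝓝 L) →
      Integrable (fun x : ℝ => N (x + c * I) / (x + c * I - p)) →
      Tendsto (fun R : ℝ => ∫ x in (p.re - R)..(p.re + R), D (x + c * I)) atTop
        (𝓝 ((∫ x : ℝ, N (x + c * I) / (x + c * I - p)) - N p * L)) := by
    intro c _ hcp L hL hint
    have hne : ∀ x : ℝ, (x + c * I : ℂ) ≠ p := by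
      intro x hx
      apply hcp
      rw [← hx]; simp
    have e0 : ∀ x : ℝ, (x + c * I - p : ℂ) = ((x - p.re : ℝ) : ℂ) + (c - p.im : ℝ) * I := by
      intro x
      apply Complex.ext <;> simp
    have hshift : ∀ R : ℝ, ∫ x in (p.re - R)..(p.re + R), (x + c * I - p : ℂ)⁻¹ =
        ∫ t in (-R)..R, ((t : ℂ) + (c - p.im : ℝ) * I)⁻¹ := by
      intro R
      simp_rw [e0]
      rw [intervalIntegral.integral_comp_sub_right
        (fun t : ℝ => ((t : ℂ) + (c - p.im : ℝ) * I)⁻¹)]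
      congr 1 <;> ring
    have hci : Continuous fun x : ℝ => (x + c * I - p : ℂ)⁻¹ :=
      Continuous.inv₀ (by fun_prop) fun x => sub_ne_zero.2 (hne x)
    have hsplit : ∀ R : ℝ, ∫ x in (p.re - R)..(p.re + R), D (x + c * I) =
        (∫ x in (p.re - R)..(p.re + R), N (x + c * I) / (x + c * I - p)) -
          N p * ∫ t in (-R)..R, ((t : ℂ) + (c - p.im : ℝ) * I)⁻¹ := by
      intro R
      rw [← hshift, ← intervalIntegral.integral_const_mul,
        ← intervalIntegral.integral_sub hint.intervalIntegrable
          ((hci.const_mul _).intervalIntegrable _ _)]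
      exact intervalIntegral.integral_congr fun x _ => hDeq _ (hne x)
    simp_rw [hsplit]
    refine Tendsto.sub (intervalIntegral_tendsto_integral hint ?_ ?_) (hL.const_mul _)
    · exact tendsto_atBot_add_const_left _ _ tendsto_neg_atTop_atBot
    · exact tendsto_atTop_add_const_left _ _ tendsto_id
  -- the vertical sides vanish in the limit
  have hvert : ∀ s : ℝ, |s| = 1 →
      Tendsto (fun R : ℝ => ∫ y in a..b, D ((p.re + s * R : ℝ) + y * I)) atTop (𝓝 0) := by
    intro s hs
    rw [NormedAddGroup.tendsto_nhds_zero]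
    intro η hη
    have hM : 0 < b - a := by linarith
    set η' := η / (4 * (b - a)) with hη'
    have hη'0 : 0 < η' := by positivity
    obtain ⟨T, hT⟩ := hdecay η' hη'0
    filter_upwards [eventually_ge_atTop (|p.re| + T), eventually_gt_atTop 0,
      eventually_ge_atTop (‖N p‖ / η')] with R h1 h2 h3
    have hsR : |s * R| = R := by rw [abs_mul, hs, one_mul, abs_of_pos h2]
    have hbd : ∀ y ∈ Set.uIoc a b, ‖D ((p.re + s * R : ℝ) + y * I)‖ ≤ 2 * η' := by
      intro y hy
      rw [uIoc_of_le hab] at hy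
      set z : ℂ := ((p.re + s * R : ℝ) : ℂ) + y * I with hz
      have hre : (z - p).re = s * R := by simp [hz]
      have hzR : R ≤ ‖z - p‖ := by
        have := abs_re_le_norm (z - p)
        rwa [hre, hsR] at this
      have hzp : z ≠ p := by
        intro h; rw [h, sub_self, norm_zero] at hzR; linarith
      rw [hDeq z hzp]
      refine (norm_sub_le _ _).trans ?_
      have g1 : ‖N z / (z - p)‖ ≤ η' := by
        refine hT _ ?_ y (Ioc_subset_Icc_self hy)
        have : |s * R| ≤ |p.re + s * R| + |p.re| := by
          have := abs_sub (p.re + s * R) p.re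
          rwa [add_sub_cancel_left] at this
        rw [hsR] at this; linarith
      have g2 : ‖N p * (z - p)⁻¹‖ ≤ η' := by
        rw [norm_mul, norm_inv, ← div_eq_mul_inv, div_le_iff₀ (h2.trans_le hzR)]
        rw [div_le_iff₀ hη'0] at h3
        have := mul_le_mul_of_nonneg_left hzR hη'0.le
        linarith
      linarith
    have h4 := intervalIntegral.norm_integral_le_of_norm_le_const hbd
    rw [abs_of_pos hM] at h4
    have h5 : 2 * η' * (b - a) = η / 2 := by rw [hη']; field_simp; norm_num
    linarith
  have hrect : ∀ R : ℝ,
      (∫ x in (p.re - R)..(p.re + R), D (x + a * I)) -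
        (∫ x in (p.re - R)..(p.re + R), D (x + b * I)) +
        I * (∫ y in a..b, D ((p.re + 1 * R : ℝ) + y * I)) -
        I * (∫ y in a..b, D ((p.re + (-1) * R : ℝ) + y * I)) = 0 := by
    intro R
    have := integral_boundary_rect_eq_zero_of_differentiableOn D ⟨p.re - R, a⟩ ⟨p.re + R, b⟩
      (hDdiff.mono fun z hz => by
        have := hz.2
        rw [uIcc_of_le hab] at this
        exact this)
    simpa [sub_eq_add_neg] using this
  have hlim := (((hline a ⟨le_rfl, hab⟩ hap.ne _
      (tendsto_integral_inv_of_neg (sub_neg.2 hap)) ha).sub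
    (hline b ⟨hab, le_rfl⟩ hpb.ne' _
      (tendsto_integral_inv_of_pos (sub_pos.2 hpb)) hb)).add
    ((hvert 1 (by simp)).const_mul I)).sub ((hvert (-1) (by simp)).const_mul I)
  simp_rw [hrect] at hlim
  have := tendsto_nhds_unique hlim tendsto_const_nhds
  linear_combination this

/-! ### Evaluation of the contour integral -/

/-- The function `u ↦ 1 / (1 + e^{-iu})`, with simple poles at `π + 2πℤ`. -/
def fermi (u : ℂ) : ℂ := 1 / (1 + exp (-I * u))

lemma one_add_exp_eq_zero_iff {u : ℂ} :
    1 + exp (-I * u) = 0 ↔ ∃ k : ℤ, u = Real.pi + 2 * Real.pi * k := by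
  have h : 1 + exp (-I * u) = 0 ↔ exp (-I * u) = exp (Real.pi * I) := by
    rw [exp_pi_mul_I, eq_neg_iff_add_eq_zero, add_comm]
  rw [h, exp_eq_exp_iff_exists_int]
  constructor
  · rintro ⟨n, hn⟩
    refine ⟨-1 - n, ?_⟩
    push_cast
    linear_combination I * hn + (u + Real.pi + 2 * Real.pi * n) * I_sq
  · rintro ⟨k, rfl⟩
    refine ⟨-1 - k, ?_⟩
    push_cast; ring

/-- No point of the lines `π + 2πk + ie^{-iθ}ℝ` lies in the strip. The case `s = 0` says that the
strip contains no pole of `fermi`, the other cases that the half line `e^{-iθ}[0, ∞)` avoids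
`poleSet w`. -/
lemma not_pole_of_mem_W {θ δ : ℝ} (hδ : 0 < δ) (hc : 0 < Real.cos θ) {w : ℂ} (hw : w ∈ W θ δ)
    {s : ℝ} {k : ℤ} : w ≠ Real.pi + 2 * Real.pi * k + s * (I * exp (-θ * I)) := by
  intro h
  have hk : w.re * Real.cos θ - w.im * Real.sin θ = Real.pi * (1 + 2 * k) * Real.cos θ := by
    have e : exp (-θ * I) = (Real.cos θ : ℂ) - Real.sin θ * I := by
      rw [exp_mul_I]; simp [sub_eq_add_neg]
    have hre := congrArg Complex.re h
    have him := congrArg Complex.im h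
    rw [e] at hre him
    simp [sin_ofReal_re, cos_ofReal_re] at hre him
    rw [hre, him]; ring
  obtain ⟨h1, h2⟩ := hw
  rw [hk] at h1 h2
  have hpc : 0 < Real.pi * Real.cos θ := mul_pos Real.pi_pos hc
  have g1 : (-1 : ℝ) < 1 + 2 * k := by
    by_contra hcon; push Not at hcon
    nlinarith
  have g2 : (1 + 2 * k : ℝ) < 1 := by
    by_contra hcon; push Not at hcon
    nlinarith
  have g1' : (-1 : ℤ) < 1 + 2 * k := by exact_mod_cast g1
  have g2' : (1 + 2 * k : ℤ) < 1 := by exact_mod_cast g2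
  omega

lemma one_add_exp_ne_zero_of_mem_W {θ δ : ℝ} (hδ : 0 < δ) (hc : 0 < Real.cos θ) {w : ℂ}
    (hw : w ∈ W θ δ) : 1 + exp (-I * w) ≠ 0 := by
  intro h
  obtain ⟨k, hk⟩ := one_add_exp_eq_zero_iff.1 h
  exact not_pole_of_mem_W hδ hc hw (s := 0) (k := k) (by simpa using hk)

/-- Shifting the contour by `i` multiplies the integrand by `-e^{iw}` and crosses the single pole
`z = i`, which evaluates the integral. -/
theorem integral_expSinh_contour {θ δ ε : ℝ} (hδ : 0 < δ) (hε : ε ∈ Ioo 0 (Real.cos θ)) {w : ℂ}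
    (hw : w ∈ W θ δ) :
    ∫ t : ℝ, expSinh w (contour θ ε t) * exp (θ * I) = 2 / I * fermi w := by
  have hc : 0 < Real.cos θ := hε.1.trans hε.2
  have hc1 : Real.cos θ ≤ 1 := Real.cos_le_one θ
  set u : ℂ := exp (θ * I) with hu
  have hu0 : u ≠ 0 := exp_ne_zero _
  -- the point `z = i` in the rotated coordinate `ζ = e^{-iθ} z`
  set p : ℂ := (Real.sin θ : ℂ) + Real.cos θ * I with hp
  have hup : u * p = I := by
    rw [hu, hp]
    apply Complex.ext
    · rw [re_rot_mul]; simp; ring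
    · rw [im_rot_mul]; simp; nlinarith [Real.sin_sq_add_cos_sq θ]
  have hpim : p.im = Real.cos θ := by simp [hp, cos_ofReal_re]
  set S : ℂ → ℂ := fun ζ => sinh ((Real.pi : ℂ) * (u * ζ)) with hS
  have hSdiff : Differentiable ℂ S := by rw [hS]; fun_prop
  have hSp : S p = 0 := by
    simp only [hS, hup]; exact sinh_pi_mul_eq_zero_iff.2 ⟨1, by simp⟩
  set q : ℂ → ℂ := dslope S p with hq
  have hqdiff : Differentiable ℂ q := by
    rw [← differentiableOn_univ] at hSdiff ⊢
    exact (differentiableOn_dslope univ_mem).2 hSdiff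
  have hqp : q p = -(Real.pi * u) := by
    have h1 : HasDerivAt S (cosh ((Real.pi : ℂ) * (u * p)) * (Real.pi * (u * 1))) p :=
      (((hasDerivAt_id p).const_mul u).const_mul (Real.pi : ℂ)).csinh
    rw [hq, dslope_same, h1.deriv, hup, cosh_mul_I]
    simp
  have hqne : ∀ ζ, ζ ≠ p → q ζ = S ζ / (ζ - p) := by
    intro ζ hζ
    rw [hq, dslope_of_ne _ hζ, slope_def_field, hSp, sub_zero]
  set N : ℂ → ℂ := fun ζ => exp (w * (u * ζ)) * u / q ζ with hN
  have hNf : ∀ ζ, N ζ / (ζ - p) = expSinh w (u * ζ) * u := by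
    intro ζ
    rcases eq_or_ne ζ p with hζ | hζ
    · have h0 : sinh ((Real.pi : ℂ) * (u * p)) = 0 := hSp
      rw [hζ, expSinh, h0]; simp
    · have hz : ζ - p ≠ 0 := sub_ne_zero.2 hζ
      simp only [hN, expSinh, hqne ζ hζ, hS]
      field_simp
  have hq0 : ∀ ζ : ℂ, ζ.im ∈ Icc ε (ε + Real.cos θ) → q ζ ≠ 0 := by
    intro ζ hζ h
    rcases eq_or_ne ζ p with hζp | hζp
    · rw [hζp, hqp] at h
      exact neg_ne_zero.2 (mul_ne_zero (by exact_mod_cast Real.pi_ne_zero) hu0) h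
    · rw [hqne ζ hζp, div_eq_zero_iff, or_iff_left (sub_ne_zero.2 hζp)] at h
      simp only [hS] at h
      rw [← re_add_im ζ] at h
      obtain ⟨k, hk1, hk2⟩ := im_eq_of_sinh_eq_zero h
      rw [hk1] at hζ
      obtain ⟨g1, g2⟩ := hζ
      have hk0 : (0 : ℝ) < k := by
        by_contra hcon; push Not at hcon
        have := mul_nonpos_of_nonpos_of_nonneg hcon hc.le
        linarith [hε.1]
      have hk3 : (k : ℝ) < 2 := by
        by_contra hcon; push Not at hcon
        nlinarith [hε.2]
      have hk0' : 0 < k := by exact_mod_cast hk0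
      have hk3' : k < 2 := by exact_mod_cast hk3
      obtain rfl : k = 1 := by omega
      apply hζp
      apply Complex.ext <;> simp [hp, hk1, hk2, sin_ofReal_re, cos_ofReal_re]
  have hline : ∀ x : ℝ, N (x + ε * I) / (x + ε * I - p) = expSinh w (contour θ ε x) * u :=
    fun x => hNf _
  -- `z ↦ z + i` is the shift by `p` in the rotated coordinate, hence also a real shift by `sin θ`
  have hperiod : ∀ x : ℝ, N (x + (ε + Real.cos θ : ℝ) * I) / (x + (ε + Real.cos θ : ℝ) * I - p) =
      -exp (I * w) * (expSinh w (contour θ ε (x - Real.sin θ)) * u) := by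
    intro x
    rw [hNf]
    have e : u * (x + (ε + Real.cos θ : ℝ) * I) = contour θ ε (x - Real.sin θ) + I := by
      rw [contour, ← hu, ofReal_add, ofReal_sub]
      linear_combination hup - u * hp
    rw [e, expSinh, expSinh, mul_add, mul_add, exp_add, sinh_add, sinh_mul_I, cosh_mul_I]
    simp only [← ofReal_sin, ← ofReal_cos, Real.sin_pi, Real.cos_pi]
    push_cast
    rw [mul_comm w I]
    ring
  have hint : Integrable fun x : ℝ => expSinh w (contour θ ε x) * u := by
    have h1 := integrable_norm_expSinh_mul_exp hε le_rfl hδ hw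
    simp only [zero_mul, Real.exp_zero, mul_one] at h1
    exact (((integrable_norm_iff
      (continuous_expSinh_contour hε w).aestronglyMeasurable).1 h1)).mul_const u
  have hres := integral_sub_integral_of_simple_pole (N := N) (a := ε) (b := ε + Real.cos θ)
    (p := p) (by rw [hpim]; exact hε.2) (by rw [hpim]; linarith [hε.1])
    (fun ζ hζ => DifferentiableAt.div (by fun_prop) (hqdiff ζ) (hq0 ζ hζ))
    (by simp_rw [hline]; exact hint)
    (by
      simp_rw [hperiod]
      exact (hint.comp_sub_right (Real.sin θ)).const_mul _)
    (by
      intro η hη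
      have hlim : Tendsto (fun s : ℝ => 4 * Real.exp ((‖w‖ + Real.pi) * 2) * Real.exp (-(δ * s)))
          atTop (𝓝 0) := by
        have := (Real.tendsto_exp_neg_atTop_nhds_zero.comp
          (tendsto_id.const_mul_atTop hδ)).const_mul (4 * Real.exp ((‖w‖ + Real.pi) * 2))
        simpa using this
      have hev := hlim.eventually (Iic_mem_nhds hη)
      obtain ⟨T, hT⟩ := eventually_atTop.1 hev
      refine ⟨max T ((1 / Real.pi + 2) / Real.cos θ), fun x hx y hy => ?_⟩
      have hy2 : |y| ≤ 2 := by
        rw [abs_of_nonneg (hε.1.le.trans hy.1)]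
        linarith [hy.2, hε.2]
      have hx2 := (le_max_right _ _).trans hx
      rw [div_le_iff₀ hc] at hx2
      have h1 : 1 ≤ Real.pi * (|x| * Real.cos θ - |y|) := by
        have e1 : Real.pi * (1 / Real.pi) = 1 := by field_simp
        have e2 : 1 / Real.pi ≤ |x| * Real.cos θ - |y| := by linarith
        have := mul_le_mul_of_nonneg_left e2 Real.pi_pos.le
        linarith
      rw [hNf, norm_mul, hu, norm_exp_ofReal_mul_I, mul_one]
      refine (norm_expSinh_le hc hw h1).trans ((le_trans ?_ (hT |x| ((le_max_left _ _).trans hx))))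
      rw [neg_mul]
      gcongr)
  simp_rw [hline, hperiod] at hres
  rw [integral_const_mul, integral_sub_right_eq_self
    (fun x : ℝ => expSinh w (contour θ ε x) * u)] at hres
  set G := ∫ t : ℝ, expSinh w (contour θ ε t) * u
  have hNp : N p = -exp (I * w) / Real.pi := by
    simp only [hN, hqp, hup]
    have : (Real.pi : ℂ) ≠ 0 := by exact_mod_cast Real.pi_ne_zero
    rw [mul_comm w I]
    field_simp
  rw [hNp] at hres
  have hne := one_add_exp_ne_zero_of_mem_W hδ hc hw
  have hee : exp (I * w) * exp (-I * w) = 1 := by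
    rw [← exp_add]; simp
  have hpi : (Real.pi : ℂ) ≠ 0 := by exact_mod_cast Real.pi_ne_zero
  rw [fermi, mul_one_div, div_div, eq_div_iff (mul_ne_zero I_ne_zero hne)]
  have hres' : G + exp (I * w) * G = -2 * I * exp (I * w) := by
    have e : 2 * (Real.pi : ℂ) * I * (-exp (I * w) / Real.pi) = -2 * I * exp (I * w) := by
      field_simp
    rw [← e, ← hres]; ring
  linear_combination (I * exp (-I * w)) * hres' - (I * G + 2 * I ^ 2) * hee - 2 * I_sq

/-- Transport of a sum along termwise equality; stated for `ℂ` so that the additive structures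
of the two sides agree syntactically. -/
lemma hasSum_of_eq {ι : Type*} {u v : ι → ℂ} {a b : ℂ} (h : HasSum u a) (huv : ∀ i, v i = u i)
    (hab : b = a) : HasSum v b := by
  rw [funext huv, hab]; exact h

/-! ### Partial fractions and the Laurent coefficients of `1 / sinh` -/

lemma inv_sin_eq_cot_sub_cot {y : ℂ} (hs : Complex.sin y ≠ 0) :
    (Complex.sin y)⁻¹ = Complex.cot (y / 2) - Complex.cot y := by
  have h1 : Complex.sin y = 2 * Complex.sin (y / 2) * Complex.cos (y / 2) := by
    rw [← Complex.sin_two_mul, mul_div_cancel₀ _ (two_ne_zero' ℂ)]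
  have h2 : Complex.cos y = 2 * Complex.cos (y / 2) ^ 2 - 1 := by
    rw [← Complex.cos_two_mul, mul_div_cancel₀ _ (two_ne_zero' ℂ)]
  have hs' := hs
  rw [h1] at hs'
  have ha : Complex.sin (y / 2) ≠ 0 := fun h => hs' (by rw [h]; ring)
  have hb : Complex.cos (y / 2) ≠ 0 := fun h => hs' (by rw [h]; ring)
  rw [Complex.cot, Complex.cot, h1, h2]
  field_simp
  ring

/-- The partial fraction expansion of `π / sin(πx)`, from that of the cotangent at `x` and at
`x / 2`. -/
lemma hasSum_pi_div_sin {x : ℂ} (hx : x ∈ integerComplement) :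
    HasSum (fun n : ℕ => (-1) ^ (n + 1) * (2 * x / (x ^ 2 - (n + 1) ^ 2)))
      (Real.pi / Complex.sin (Real.pi * x) - 1 / x) := by
  have hx2 : x / 2 ∈ integerComplement := by
    rintro ⟨k, hk⟩
    refine hx ⟨2 * k, ?_⟩
    push_cast; rw [hk]; ring
  have hx0 : x ≠ 0 := integerComplement.ne_zero hx
  have hterm : ∀ n : ℕ, cotTerm x n = 2 * x / (x ^ 2 - (n + 1) ^ 2) := fun n => by
    rw [cotTerm_identity hx n, mul_one_div]
    congr 1; ring
  have h1 : HasSum (fun n : ℕ => 2 * x / (x ^ 2 - (n + 1) ^ 2))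
      (Real.pi * Complex.cot (Real.pi * x) - 1 / x) := by
    have := (summable_cotTerm hx).hasSum
    rw [cot_series_rep' hx]
    simp only [hterm] at this
    exact hasSum_of_eq this (fun n => rfl) (tsum_congr hterm)
  -- the expansion at `x / 2` consists of the terms of odd index at `x`, doubled
  have h2 : HasSum (fun n : ℕ => 2 * (2 * x / (x ^ 2 - ((2 * n + 1 : ℕ) + 1) ^ 2)))
      (Real.pi * Complex.cot (Real.pi * (x / 2)) - 1 / (x / 2)) := by
    have h3 := (summable_cotTerm hx2).hasSum
    have h4 : ∀ n : ℕ, cotTerm (x / 2) n = 2 * (2 * x / (x ^ 2 - ((2 * n + 1 : ℕ) + 1) ^ 2)) := by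
      intro n
      rw [cotTerm_identity hx2 n, mul_one_div]
      have e : (x / 2 + (n + 1)) * (x / 2 - (n + 1)) = (x ^ 2 - ((2 * n + 1 : ℕ) + 1) ^ 2) / 4 := by
        push_cast; ring
      rw [e, div_div_eq_mul_div]; ring
    rw [cot_series_rep' hx2]
    simp only [h4] at h3
    exact hasSum_of_eq h3 (fun n => rfl) (tsum_congr h4)
  have hinj : Function.Injective fun n : ℕ => 2 * n + 1 := fun a b h => by simpa using h
  have h5 : HasSum (fun n : ℕ => (1 + (-1) ^ (n + 1)) * (2 * x / (x ^ 2 - (n + 1) ^ 2)))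
      (Real.pi * Complex.cot (Real.pi * (x / 2)) - 1 / (x / 2)) := by
    rw [← hinj.hasSum_iff]
    · refine hasSum_of_eq h2 (fun n => ?_) rfl
      simp only [Function.comp]
      rw [show 2 * n + 1 + 1 = 2 * (n + 1) by ring, pow_mul]
      norm_num
    · intro n hn
      have : Even n := by
        by_contra hodd
        obtain ⟨k, rfl⟩ := Nat.not_even_iff_odd.1 hodd
        exact hn ⟨k, rfl⟩
      rw [Even.add_one this |>.neg_one_pow]; simp
  refine hasSum_of_eq (h5.sub h1) (fun n => ?_) ?_
  · ring
  · rw [div_eq_mul_inv, inv_sin_eq_cot_sub_cot (sin_pi_mul_ne_zero hx), mul_div_assoc]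
    field_simp
    ring

/-- The coefficient of `z^{m+1}` in the expansion of the `n`-th partial fraction
`2 (-1)^n z / (z² + π² n²)` of `1 / sinh z`. -/
def fracCoeff (n m : ℕ) : ℂ :=
  (-1) ^ n / ((Real.pi : ℂ) * n) ^ 2 *
    ((I / (Real.pi * n)) ^ m + (-I / (Real.pi * n)) ^ m)

lemma norm_fracCoeff_succ_le (n m : ℕ) :
    ‖fracCoeff (n + 1) m‖ ≤ 2 / ((n : ℝ) + 1) ^ 2 * (1 / Real.pi) ^ m := by
  have hpi := Real.pi_pos
  have hpi1 : 1 ≤ Real.pi := by linarith [Real.pi_gt_three]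
  have hn : (1 : ℝ) ≤ (n : ℝ) + 1 := by linarith [n.cast_nonneg (α := ℝ)]
  have hnn : ‖(Real.pi : ℂ) * ((n + 1 : ℕ) : ℂ)‖ = Real.pi * ((n : ℝ) + 1) := by
    rw [norm_mul, norm_real, Real.norm_of_nonneg hpi.le, Complex.norm_natCast]; push_cast; rfl
  have hI : ∀ s : ℂ, ‖s‖ = 1 →
      ‖(s / ((Real.pi : ℂ) * ((n + 1 : ℕ) : ℂ))) ^ m‖ ≤ (1 / Real.pi) ^ m := by
    intro s hs
    rw [norm_pow, norm_div, hs, hnn]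
    refine pow_le_pow_left₀ (by positivity) (one_div_le_one_div_of_le hpi ?_) m
    nlinarith
  rw [fracCoeff, norm_mul, norm_div, norm_pow, norm_pow, norm_neg, norm_one, one_pow, hnn]
  have h1 := (norm_add_le _ _).trans (add_le_add (hI I norm_I) (hI (-I) (by simp)))
  have h2 : 1 / (Real.pi * ((n : ℝ) + 1)) ^ 2 ≤ 1 / ((n : ℝ) + 1) ^ 2 := by
    refine one_div_le_one_div_of_le (by positivity) (pow_le_pow_left₀ (by positivity) ?_ 2)
    nlinarith
  calc _ ≤ 1 / ((n : ℝ) + 1) ^ 2 * ((1 / Real.pi) ^ m + (1 / Real.pi) ^ m) :=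
        mul_le_mul h2 h1 (norm_nonneg _) (by positivity)
    _ = _ := by ring

lemma summable_two_div_succ_sq : Summable fun n : ℕ => 2 / ((n : ℝ) + 1) ^ 2 := by
  have h := (summable_nat_add_iff 1).2 (Real.summable_one_div_nat_pow.2 (le_refl 2))
  refine (h.mul_left 2).congr fun n => ?_
  push_cast; ring

lemma hasSum_fracCoeff_mul_pow (n : ℕ) {z : ℂ} (hz : ‖z‖ < Real.pi) :
    HasSum (fun m : ℕ => fracCoeff (n + 1) m * z ^ (m + 1))
      (2 * (-1) ^ (n + 1) * z / (z ^ 2 + (Real.pi * (n + 1)) ^ 2)) := by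
  have hpi := Real.pi_pos
  set a : ℂ := (Real.pi : ℂ) * ((n + 1 : ℕ) : ℂ) with ha
  have hna : Real.pi ≤ ‖a‖ := by
    rw [ha, norm_mul, norm_real, Real.norm_of_nonneg hpi.le, Complex.norm_natCast]
    push_cast
    nlinarith [n.cast_nonneg (α := ℝ)]
  have ha0 : a ≠ 0 := norm_pos_iff.1 (hpi.trans_le hna)
  have hlt : ∀ s : ℂ, ‖s‖ = 1 → ‖s / a * z‖ < 1 := by
    intro s hs
    rw [norm_mul, norm_div, hs, div_mul_eq_mul_div, one_mul, div_lt_one (hpi.trans_le hna)]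
    exact hz.trans_le hna
  have hne : ∀ s : ℂ, ‖s‖ = 1 → 1 - s / a * z ≠ 0 := by
    intro s hs h
    have := hlt s hs
    rw [← sub_eq_zero.1 h, norm_one] at this
    exact lt_irrefl _ this
  have h1 := hasSum_geometric_of_norm_lt_one (hlt I norm_I)
  have h2 := hasSum_geometric_of_norm_lt_one (hlt (-I) (by simp))
  have h3 := (h1.add h2).mul_left ((-1) ^ (n + 1) / a ^ 2 * z)
  refine hasSum_of_eq h3 (fun m => ?_) ?_
  · rw [fracCoeff, mul_pow, mul_pow]; ring
  · have e1 := hne I norm_I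
    have e2 := hne (-I) (by simp)
    have e3 : (1 - I / a * z) * (1 - -I / a * z) = (z ^ 2 + a ^ 2) / a ^ 2 := by
      field_simp
      linear_combination (-z ^ 2) * I_sq
    have e4 : z ^ 2 + a ^ 2 ≠ 0 := by
      intro h
      rw [h, zero_div] at e3
      exact mul_ne_zero e1 e2 e3
    have e5 : (1 - I / a * z)⁻¹ + (1 - -I / a * z)⁻¹ = 2 * a ^ 2 / (z ^ 2 + a ^ 2) := by
      rw [inv_add_inv e1 e2, e3]
      field_simp
      ring
    rw [e5, ha]
    rw [ha] at ha0 e4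
    push_cast at ha0 e4 ⊢
    field_simp

lemma summable_fracCoeff_prod {c : ℕ → ℂ} (hc : Summable fun m => ‖c m‖ * (1 / Real.pi) ^ m) :
    Summable fun q : ℕ × ℕ => fracCoeff (q.1 + 1) q.2 * c q.2 := by
  refine Summable.of_norm_bounded (Summable.mul_of_nonneg summable_two_div_succ_sq hc
    (fun n => by positivity) (fun m => by positivity)) fun q => ?_
  rw [norm_mul]
  refine (mul_le_mul_of_nonneg_right (norm_fracCoeff_succ_le q.1 q.2) (norm_nonneg _)).trans ?_
  apply le_of_eq; ring

/-- The partial fraction expansion of `1 / sinh z`. -/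
lemma hasSum_f_sub_inv {z : ℂ} (h0 : z ≠ 0) (hz : ‖z‖ < Real.pi) :
    HasSum (fun n : ℕ => 2 * (-1) ^ (n + 1) * z / (z ^ 2 + (Real.pi * (n + 1)) ^ 2))
      (f z - z⁻¹) := by
  have hpi : (Real.pi : ℂ) ≠ 0 := by exact_mod_cast Real.pi_ne_zero
  have hx : I * z / Real.pi ∈ integerComplement := by
    rintro ⟨k, hk⟩
    have hn : ‖(k : ℂ)‖ < 1 := by
      rw [hk, norm_div, norm_mul, norm_I, one_mul, norm_real, Real.norm_of_nonneg Real.pi_pos.le,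
        div_lt_one Real.pi_pos]
      exact hz
    rw [Complex.norm_intCast] at hn
    have hk0 : k = 0 := by
      have : |k| < 1 := by exact_mod_cast hn
      exact Int.abs_lt_one_iff.1 this
    rw [hk0, Int.cast_zero, eq_comm, div_eq_zero_iff, or_iff_left hpi] at hk
    exact mul_ne_zero I_ne_zero h0 hk
  have h := (hasSum_pi_div_sin hx).mul_left (I / (Real.pi : ℂ))
  have hs := sin_pi_mul_ne_zero hx
  have e : (Real.pi : ℂ) * (I * z / Real.pi) = z * I := by field_simp
  rw [e, sin_mul_I] at h hs
  have hs' : sinh z ≠ 0 := left_ne_zero_of_mul hs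
  refine hasSum_of_eq h (fun n => ?_) ?_
  · have e2 : (I * z / Real.pi) ^ 2 - ((n : ℂ) + 1) ^ 2 =
        -(z ^ 2 + (Real.pi * (n + 1)) ^ 2) / Real.pi ^ 2 := by
      field_simp
      linear_combination z ^ 2 * I_sq
    rw [e2, div_div_eq_mul_div, div_neg, mul_neg, mul_neg]
    have e3 : I / (Real.pi : ℂ) * ((-1) ^ (n + 1) * (2 * (I * z / Real.pi) * Real.pi ^ 2 /
        (z ^ 2 + (Real.pi * (n + 1)) ^ 2))) =
        I ^ 2 * (2 * (-1) ^ (n + 1) * z / (z ^ 2 + (Real.pi * (n + 1)) ^ 2)) := by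
      field_simp
    rw [e3, I_sq]; ring
  · rw [f]
    field_simp

lemma circleIntegral_zpow_eq_ite (k : ℤ) :
    (∮ z in C(0, 1), z ^ k) = if k = -1 then 2 * (Real.pi : ℂ) * I else 0 := by
  split_ifs with h
  · have := circleIntegral.integral_sub_center_inv (0 : ℂ) (one_ne_zero (α := ℝ))
    simpa [h, zpow_neg_one] using this
  · have := circleIntegral.integral_sub_zpow_of_ne h 0 0 1
    simpa using this

/-- The Laurent coefficients of `1 / sinh z` of nonnegative order `m + 1 ≥ 1`, summed over the
partial fractions. For odd `m` every summand vanishes. -/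
theorem hasSum_laurentCoeff (M : ℕ) :
    HasSum (fun n : ℕ => fracCoeff (n + 1) M) (laurentCoeff ((M + 1 : ℕ) : ℤ)) := by
  have hpi : (Real.pi : ℂ) ≠ 0 := by exact_mod_cast Real.pi_ne_zero
  have hpi3 := Real.pi_gt_three
  have hgeo : Summable fun m : ℕ => (1 / Real.pi) ^ m :=
    summable_geometric_of_lt_one (by positivity) (by
      rw [div_lt_one Real.pi_pos]; linarith)
  have hz1 : ∀ t : ℝ, ‖circleMap 0 1 t‖ = 1 := fun t => by simp
  have hpt : ∀ z : ℂ, ‖z‖ = 1 →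
      HasSum (fun q : ℕ × ℕ => fracCoeff (q.1 + 1) q.2 * z ^ (q.2 + 1)) (f z - z⁻¹) := by
    intro z hz
    have h0 : z ≠ 0 := norm_pos_iff.1 (by rw [hz]; norm_num)
    have hlt : ‖z‖ < Real.pi := by rw [hz]; linarith
    have hs := summable_fracCoeff_prod (c := fun m => z ^ (m + 1)) (by simpa [hz] using hgeo)
    have h1 := hs.hasSum.prod_fiberwise fun n => hasSum_fracCoeff_mul_pow n hlt
    rw [← h1.unique (hasSum_f_sub_inv h0 hlt)]
    exact hs.hasSum
  have hmem0 : ∀ t : ℝ, circleMap 0 1 t ≠ 0 := fun t => circleMap_ne_center one_ne_zero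
  -- termwise integration of the double series over the unit circle
  have hint : HasSum (fun q : ℕ × ℕ => ∮ z in C(0, 1),
      fracCoeff (q.1 + 1) q.2 * z ^ ((q.2 : ℤ) - M - 1))
      (∮ z in C(0, 1), (f z - z⁻¹) * z ^ (-((M + 1 : ℕ) : ℤ) - 1)) := by
    unfold circleIntegral
    refine intervalIntegral.hasSum_integral_of_dominated_convergence
      (fun q _ => 2 / ((q.1 : ℝ) + 1) ^ 2 * (1 / Real.pi) ^ q.2) ?_ ?_ ?_ ?_ ?_
    · intro q
      refine Continuous.aestronglyMeasurable ?_
      simp only [deriv_circleMap]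
      refine Continuous.smul ((continuous_circleMap 0 1).mul continuous_const)
        (Continuous.mul continuous_const ?_)
      exact (continuous_circleMap 0 1).zpow₀ _ fun t => Or.inl (hmem0 t)
    · intro q
      refine Eventually.of_forall fun t _ => ?_
      rw [deriv_circleMap, norm_smul, norm_mul, norm_mul, norm_zpow, hz1, one_zpow, norm_I]
      simpa using norm_fracCoeff_succ_le q.1 q.2
    · exact Eventually.of_forall fun t _ => Summable.mul_of_nonneg summable_two_div_succ_sq hgeo
        (fun n => by positivity) (fun m => by positivity)
    · exact intervalIntegrable_const
    · refine Eventually.of_forall fun t _ => ?_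
      have h := ((hpt _ (hz1 t)).mul_right (circleMap 0 1 t ^ (-((M + 1 : ℕ) : ℤ) - 1))).const_smul
        (deriv (circleMap 0 1) t)
      refine hasSum_of_eq h (fun q => ?_) rfl
      rw [mul_assoc, ← zpow_natCast, ← zpow_add₀ (hmem0 t),
        show ((q.2 + 1 : ℕ) : ℤ) + (-((M + 1 : ℕ) : ℤ) - 1) = (q.2 : ℤ) - M - 1 by push_cast; ring]
  -- the polar part `1 / z` does not contribute
  have hL : laurentCoeff ((M + 1 : ℕ) : ℤ) = (2 * (Real.pi : ℂ) * I)⁻¹ *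
      ∮ z in C(0, 1), (f z - z⁻¹) * z ^ (-((M + 1 : ℕ) : ℤ) - 1) := by
    rw [laurentCoeff]
    congr 1
    have hmem : ∀ z ∈ Metric.sphere (0 : ℂ) 1, z ≠ 0 ∧ sinh z ≠ 0 := by
      intro z hz
      rw [mem_sphere_zero_iff_norm] at hz
      have h0 : z ≠ 0 := norm_pos_iff.1 (by rw [hz]; norm_num)
      refine ⟨h0, fun h => ?_⟩
      have e : (Real.pi : ℂ) * (z / Real.pi) = z := by field_simp
      rw [← e] at h
      obtain ⟨k, hk⟩ := sinh_pi_mul_eq_zero_iff.1 h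
      have hn : ‖(k : ℂ)‖ < 1 := by
        have : ‖z / Real.pi‖ = ‖(k : ℂ)‖ := by rw [hk, norm_mul, norm_I, mul_one]
        rw [← this, norm_div, hz, norm_real, Real.norm_of_nonneg Real.pi_pos.le,
          div_lt_one Real.pi_pos]
        linarith
      rw [Complex.norm_intCast] at hn
      have hk0 : k = 0 := by
        have : |k| < 1 := by exact_mod_cast hn
        exact Int.abs_lt_one_iff.1 this
      rw [hk0] at hk
      apply h0
      rw [← e, hk]; simp
    have hc : ∀ k : ℤ, ContinuousOn (fun z : ℂ => z ^ k) (Metric.sphere 0 1) := fun k =>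
      continuousOn_id.zpow₀ k fun z hz => Or.inl (hmem z hz).1
    have hf : ContinuousOn f (Metric.sphere 0 1) :=
      ContinuousOn.div continuousOn_const Complex.continuous_sinh.continuousOn
        fun z hz => (hmem z hz).2
    have hpole : (∮ z in C(0, 1), z⁻¹ * z ^ (-((M + 1 : ℕ) : ℤ) - 1)) = 0 := by
      have e : (∮ z in C(0, 1), z⁻¹ * z ^ (-((M + 1 : ℕ) : ℤ) - 1)) =
          ∮ z in C(0, 1), z ^ (-1 + (-((M + 1 : ℕ) : ℤ) - 1)) := by
        refine circleIntegral.integral_congr zero_le_one fun z hz => ?_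
        rw [← zpow_neg_one, ← zpow_add₀ (hmem z hz).1]
      rw [e, circleIntegral_zpow_eq_ite, if_neg (by push_cast; omega)]
    have hsub := circleIntegral.integral_sub
      ((hf.mul (hc (-((M + 1 : ℕ) : ℤ) - 1))).circleIntegrable zero_le_one)
      ((((hc (-1)).congr fun z _ => (zpow_neg_one z).symm).mul
        (hc (-((M + 1 : ℕ) : ℤ) - 1))).circleIntegrable zero_le_one)
    simp only [Pi.mul_apply] at hsub
    rw [hpole, sub_zero] at hsub
    rw [← hsub]
    simp only [sub_mul]
  have hrow : ∀ n : ℕ, HasSum (fun m : ℕ => ∮ z in C(0, 1),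
      fracCoeff (n + 1) m * z ^ ((m : ℤ) - M - 1))
      (fracCoeff (n + 1) M * (2 * (Real.pi : ℂ) * I)) := by
    intro n
    have e : ∀ m : ℕ, (∮ z in C(0, 1), fracCoeff (n + 1) m * z ^ ((m : ℤ) - M - 1)) =
        if m = M then fracCoeff (n + 1) M * (2 * (Real.pi : ℂ) * I) else 0 := by
      intro m
      rw [circleIntegral.integral_const_mul, circleIntegral_zpow_eq_ite]
      by_cases hm : m = M
      · subst hm; simp
      · rw [if_neg (by omega), if_neg hm, mul_zero]
    simp_rw [e]
    exact hasSum_ite_eq M _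
  have h2 := (hint.prod_fiberwise hrow).mul_left ((2 * (Real.pi : ℂ) * I)⁻¹)
  rw [← hL] at h2
  refine hasSum_of_eq h2 (fun n => ?_) rfl
  have hI := I_ne_zero
  field_simp

/-! ### The Borel transform near the origin -/

/-- Near `0` the Borel transform of `g⁺` converges, and expanding the Laurent coefficients into
partial fractions and exchanging the two sums turns it into the series over `n`. -/
theorem hasSum_borel_gPlus {θ δ ε : ℝ} (hδ : 0 < δ) (hε : ε ∈ Ioo 0 (Real.cos θ)) {w : ℂ}
    (hw : w ∈ W θ δ) {ξ : ℂ} (hξ : ‖ξ‖ < δ / 2) :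
    HasSum (fun m : ℕ => PowerSeries.coeff m (borel (gPlus θ ε w)) * ξ ^ m)
      (2 / (I * (Real.pi : ℂ) ^ 2) * ∑' n : ℕ, term w ξ (n + 1)) := by
  have hpi := Real.pi_pos
  have hpi3 := Real.pi_gt_three
  have hpiC : (Real.pi : ℂ) ≠ 0 := by exact_mod_cast Real.pi_ne_zero
  set H : ℕ → ℂ := fun m => h θ ε ((m + 1 : ℕ) : ℤ) w / m.factorial with hH
  -- the moments are Taylor coefficients of `(2 / i) * fermi` at `w`
  have hG : ∀ x : ℂ, ‖x‖ < δ / 2 → HasSum (fun m : ℕ => H m * x ^ m) (2 / I * fermi (w + x)) := by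
    intro x hx
    have hwx : w + x ∈ W θ (δ / 2) := by
      have hb : |x.re * Real.cos θ - x.im * Real.sin θ| ≤ ‖x‖ := by
        have e : x.re * Real.cos θ - x.im * Real.sin θ = (x * exp (θ * I)).re := by
          rw [mul_re, exp_ofReal_mul_I_re, exp_ofReal_mul_I_im]
        rw [e]
        refine (abs_re_le_norm _).trans ?_
        rw [norm_mul, norm_exp_ofReal_mul_I, mul_one]
      have hb' := abs_le.1 hb
      obtain ⟨h1, h2⟩ := hw
      constructor <;> rw [add_re, add_im] <;> nlinarith
    have h1 := hasSum_h_mul_pow hε hw (x := x) (by linarith)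
    rw [integral_expSinh_contour (half_pos hδ) hε hwx] at h1
    refine hasSum_of_eq h1 (fun m => ?_) rfl
    simp only [hH]; ring
  have hsum : Summable fun m : ℕ => ‖H m * ξ ^ m‖ * (1 / Real.pi) ^ m := by
    refine Summable.of_nonneg_of_le (fun m => by positivity) (fun m => ?_) (hG ξ hξ).summable.norm
    refine mul_le_of_le_one_right (norm_nonneg _) (pow_le_one₀ (by positivity) ?_)
    rw [div_le_one hpi]; linarith
  have hS := summable_fracCoeff_prod hsum
  have hcol : ∀ m : ℕ, HasSum (fun n : ℕ => fracCoeff (n + 1) m * (H m * ξ ^ m))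
      (PowerSeries.coeff m (borel (gPlus θ ε w)) * ξ ^ m) := by
    intro m
    refine hasSum_of_eq ((hasSum_laurentCoeff m).mul_right (H m * ξ ^ m)) (fun n => rfl) ?_
    rw [borel, gPlus, PowerSeries.coeff_mk, PowerSeries.coeff_mk, if_neg (Nat.succ_ne_zero m)]
    simp only [hH]; ring
  have hrow : ∀ n : ℕ, HasSum (fun m : ℕ => fracCoeff (n + 1) m * (H m * ξ ^ m))
      (2 / (I * (Real.pi : ℂ) ^ 2) * term w ξ (n + 1)) := by
    intro n
    have hn0 : ((n + 1 : ℕ) : ℂ) ≠ 0 := by exact_mod_cast Nat.succ_ne_zero n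
    set a : ℂ := (Real.pi : ℂ) * ((n + 1 : ℕ) : ℂ) with ha
    have ha0 : a ≠ 0 := mul_ne_zero hpiC hn0
    have hna : 1 ≤ ‖a‖ := by
      rw [ha, norm_mul, norm_real, Real.norm_of_nonneg hpi.le, Complex.norm_natCast]
      push_cast
      nlinarith [n.cast_nonneg (α := ℝ)]
    have hlt : ∀ s : ℂ, ‖s‖ = 1 → ‖s * (ξ / a)‖ < δ / 2 := by
      intro s hs
      rw [norm_mul, hs, one_mul, norm_div]
      exact (div_le_self (norm_nonneg _) hna).trans_lt hξ
    have h1 := hG _ (hlt I norm_I)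
    have h2 := hG _ (hlt (-I) (by simp))
    have h3 := (h1.add h2).mul_left ((-1) ^ (n + 1) / a ^ 2)
    refine hasSum_of_eq h3 (fun m => ?_) ?_
    · rw [fracCoeff, mul_pow, mul_pow, div_pow, div_pow, div_pow]; ring
    · rw [term, fermi, fermi, ← ha, neg_mul I (ξ / a), ← sub_eq_add_neg, ha]
      field_simp
  have h1 := hS.hasSum.prod_fiberwise hrow
  have h2 := ((Equiv.prodComm ℕ ℕ).hasSum_iff.2 hS.hasSum).prod_fiberwise hcol
  rwa [← h1.tsum_eq, tsum_mul_left] at h2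

/-! ### Simple poles -/

/-- `u` has at `x` at most a simple pole, with residue `ρ`; the value `u x` is not constrained. -/
def HasSimplePart (u : ℂ → ℂ) (x ρ : ℂ) : Prop :=
  ∃ A : ℂ → ℂ, AnalyticAt ℂ A x ∧ u =ᶠ[𝓝[≠] x] fun z => ρ / (z - x) + A z

namespace HasSimplePart

variable {u v : ℂ → ℂ} {x ρ σ : ℂ}

lemma of_analyticAt (hu : AnalyticAt ℂ u x) : HasSimplePart u x 0 :=
  ⟨u, hu, Eventually.of_forall fun z => by simp⟩

lemma add (hu : HasSimplePart u x ρ) (hv : HasSimplePart v x σ) :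
    HasSimplePart (fun z => u z + v z) x (ρ + σ) := by
  obtain ⟨A, hA, hA'⟩ := hu
  obtain ⟨B, hB, hB'⟩ := hv
  refine ⟨fun z => A z + B z, hA.add hB, ?_⟩
  filter_upwards [hA', hB'] with z h1 h2
  rw [h1, h2]; ring

lemma const_mul (c : ℂ) (hu : HasSimplePart u x ρ) :
    HasSimplePart (fun z => c * u z) x (c * ρ) := by
  obtain ⟨A, hA, hA'⟩ := hu
  refine ⟨fun z => c * A z, analyticAt_const.mul hA, ?_⟩
  filter_upwards [hA'] with z h1
  rw [h1]; ring

lemma sum {ι : Type*} (s : Finset ι) {g : ι → ℂ → ℂ} {r : ι → ℂ}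
    (h : ∀ i ∈ s, HasSimplePart (g i) x (r i)) :
    HasSimplePart (fun z => ∑ i ∈ s, g i z) x (∑ i ∈ s, r i) := by
  classical
  induction s using Finset.induction_on with
  | empty => simpa using of_analyticAt (u := fun _ => 0) analyticAt_const
  | insert a s ha ih =>
    simp only [Finset.sum_insert ha]
    exact (h a (Finset.mem_insert_self a s)).add
      (ih fun i hi => h i (Finset.mem_insert_of_mem hi))

lemma congr (hu : HasSimplePart u x ρ) (huv : v =ᶠ[𝓝 x] u) : HasSimplePart v x ρ := by
  obtain ⟨A, hA, hA'⟩ := hu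
  exact ⟨A, hA, (huv.filter_mono nhdsWithin_le_nhds).trans hA'⟩

lemma meromorphicAt (hu : HasSimplePart u x ρ) : MeromorphicAt u x := by
  obtain ⟨A, hA, hA'⟩ := hu
  refine MeromorphicAt.congr ?_ hA'.symm
  exact ((MeromorphicAt.const ρ x).div
    ((MeromorphicAt.id x).sub (MeromorphicAt.const x x))).add hA.meromorphicAt

lemma meromorphicOrderAt_neg_iff (hu : HasSimplePart u x ρ) :
    meromorphicOrderAt u x < 0 ↔ ρ ≠ 0 := by
  have hm := hu.meromorphicAt
  obtain ⟨A, hA, hA'⟩ := hu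
  constructor
  · rintro h rfl
    have e : u =ᶠ[𝓝[≠] x] A := by
      filter_upwards [hA'] with z hz
      rw [hz]; simp
    rw [meromorphicOrderAt_congr e] at h
    exact absurd hA.meromorphicOrderAt_nonneg (not_le.2 h)
  · intro hρ
    have : meromorphicOrderAt u x = (-1 : ℤ) := by
      rw [meromorphicOrderAt_eq_int_iff hm]
      refine ⟨fun z => ρ + (z - x) * A z, by fun_prop, by simpa using hρ, ?_⟩
      filter_upwards [hA', self_mem_nhdsWithin] with z hz hzx
      have : z - x ≠ 0 := sub_ne_zero.2 hzx
      rw [hz, zpow_neg_one, smul_eq_mul]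
      field_simp
    rw [this]
    exact_mod_cast (by norm_num : (-1 : ℤ) < 0)

end HasSimplePart

lemma analyticAt_dslope {u : ℂ → ℂ} {x : ℂ} (hu : AnalyticAt ℂ u x) :
    AnalyticAt ℂ (dslope u x) x := by
  obtain ⟨p, hp⟩ := hu
  exact ⟨_, hp.has_fpower_series_dslope_fslope⟩

/-- The reciprocal of a function with a simple zero. -/
lemma HasSimplePart.one_div {g : ℂ → ℂ} {x d : ℂ} (hg : AnalyticAt ℂ g x) (h0 : g x = 0)
    (hd : HasDerivAt g d x) (hd0 : d ≠ 0) : HasSimplePart (fun z => 1 / g z) x (1 / d) := by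
  have hD := analyticAt_dslope hg
  have hDx : dslope g x x = d := by rw [dslope_same, hd.deriv]
  have hE : AnalyticAt ℂ (fun z => 1 / dslope g x z) x :=
    analyticAt_const.div hD (by rwa [hDx])
  refine ⟨dslope (fun z => 1 / dslope g x z) x, analyticAt_dslope hE, ?_⟩
  filter_upwards [self_mem_nhdsWithin] with z hz
  have hzx : z - x ≠ 0 := sub_ne_zero.2 hz
  rw [dslope_of_ne _ hz, slope_def_field, hDx, dslope_of_ne _ hz, slope_def_field, h0, sub_zero,
    one_div_div, ← add_div, add_sub_cancel, div_right_comm, div_self hzx]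

/-! ### Continuation and poles of the series -/

lemma analyticAt_fermi_comp {w c x : ℂ} (h : 1 + exp (-I * (w + I * (c * x))) ≠ 0) :
    AnalyticAt ℂ (fun ξ => fermi (w + I * (c * ξ))) x := by
  unfold fermi
  exact analyticAt_const.div (by fun_prop) h

open scoped Classical in
lemma hasSimplePart_fermi_comp (w x : ℂ) {c : ℂ} (hc : c ≠ 0) :
    HasSimplePart (fun ξ => fermi (w + I * (c * ξ))) x
      (if 1 + exp (-I * (w + I * (c * x))) = 0 then -c⁻¹ else 0) := by
  split_ifs with h
  · have hd : HasDerivAt (fun ξ => 1 + exp (-I * (w + I * (c * ξ)))) (-c) x := by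
      have h1 : HasDerivAt (fun ξ => 1 + exp (-I * (w + I * (c * ξ))))
          (exp (-I * (w + I * (c * x))) * (-I * (I * (c * 1)))) x :=
        ((((((hasDerivAt_id x).const_mul c).const_mul I).const_add w).const_mul (-I)).cexp).const_add
          1
      convert h1 using 1
      rw [eq_neg_of_add_eq_zero_right h]
      linear_combination (-c) * I_sq
    have := HasSimplePart.one_div (g := fun ξ => 1 + exp (-I * (w + I * (c * ξ)))) (x := x)
      (by fun_prop) h hd (neg_ne_zero.2 hc)
    rwa [one_div, inv_neg] at this
  · exact .of_analyticAt (analyticAt_fermi_comp h)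

lemma exp_pos_iff_neg_polePoint {w ξ : ℂ} {n : ℕ} (hn : n ≠ 0) :
    1 + exp (-I * (w + I * (((Real.pi : ℂ) * n)⁻¹ * ξ))) = 0 ↔ ∃ k : ℤ, ξ = -polePoint w n k := by
  have ha : (Real.pi : ℂ) * n ≠ 0 :=
    mul_ne_zero (by exact_mod_cast Real.pi_ne_zero) (by exact_mod_cast hn)
  rw [one_add_exp_eq_zero_iff]
  refine exists_congr fun k => ?_
  rw [polePoint]
  generalize hA : (Real.pi : ℂ) * n = a at ha ⊢
  rw [show I * (Real.pi : ℂ) * n = I * a by rw [← hA]; ring]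
  constructor
  · intro h
    have : a * (w + I * (a⁻¹ * ξ)) = a * (Real.pi + 2 * Real.pi * k) := by rw [h]
    have e : a * (w + I * (a⁻¹ * ξ)) = a * w + I * ξ := by field_simp
    rw [e] at this
    linear_combination (-I) * this + ξ * I_sq
  · rintro rfl
    field_simp
    linear_combination (-(Real.pi - w + 2 * Real.pi * k)) * I_sq

lemma exp_neg_iff_polePoint {w ξ : ℂ} {n : ℕ} (hn : n ≠ 0) :
    1 + exp (-I * (w + I * (-((Real.pi : ℂ) * n)⁻¹ * ξ))) = 0 ↔ ∃ k : ℤ, ξ = polePoint w n k := by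
  rw [show -((Real.pi : ℂ) * n)⁻¹ * ξ = ((Real.pi : ℂ) * n)⁻¹ * -ξ by ring,
    exp_pos_iff_neg_polePoint hn]
  simp only [neg_inj]

lemma term_eq_fermi (w ξ : ℂ) (n : ℕ) : term w ξ n = (-1) ^ n / (n : ℂ) ^ 2 *
    (fermi (w + I * (((Real.pi : ℂ) * n)⁻¹ * ξ)) +
      fermi (w + I * (-((Real.pi : ℂ) * n)⁻¹ * ξ))) := by
  rw [term, fermi, fermi, div_eq_inv_mul ξ, neg_mul (_⁻¹), mul_neg, ← sub_eq_add_neg]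

open scoped Classical in
/-- The residue at `ξ` of the `n`-th summand. -/
lemma hasSimplePart_term (w ξ : ℂ) {n : ℕ} (hn : n ≠ 0) :
    HasSimplePart (fun z => term w z n) ξ
      (Real.pi * ((if ∃ k : ℤ, ξ = polePoint w n k then (-1) ^ n / (n : ℂ) else 0) -
        if ∃ k : ℤ, ξ = -polePoint w n k then (-1) ^ n / (n : ℂ) else 0)) := by
  have hn' : (n : ℂ) ≠ 0 := by exact_mod_cast hn
  have ha : ((Real.pi : ℂ) * n)⁻¹ ≠ 0 :=
    inv_ne_zero (mul_ne_zero (by exact_mod_cast Real.pi_ne_zero) hn')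
  have h := ((hasSimplePart_fermi_comp w ξ ha).add
    (hasSimplePart_fermi_comp w ξ (neg_ne_zero.2 ha))).const_mul ((-1) ^ n / (n : ℂ) ^ 2)
  simp only [exp_pos_iff_neg_polePoint hn, exp_neg_iff_polePoint hn, inv_inv, inv_neg,
    neg_neg] at h
  simp only [term_eq_fermi]
  convert h using 1
  split_ifs <;> field_simp <;> ring

lemma analyticAt_term {w ξ : ℂ} {n : ℕ} (hn : n ≠ 0) (h1 : ∀ k : ℤ, ξ ≠ polePoint w n k)
    (h2 : ∀ k : ℤ, ξ ≠ -polePoint w n k) : AnalyticAt ℂ (fun z => term w z n) ξ := by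
  simp only [term_eq_fermi]
  refine analyticAt_const.mul (AnalyticAt.add (analyticAt_fermi_comp ?_) (analyticAt_fermi_comp ?_))
  · rw [Ne, exp_pos_iff_neg_polePoint hn]; push Not; exact h2
  · rw [Ne, exp_neg_iff_polePoint hn]; push Not; exact h1

/-- For `n` large the arguments `w ± iξ/(πn)` stay near `w`, uniformly for `ξ` in a disc: no poles
of index `n > N` lie there, and the summands are bounded by a convergent series. -/
lemma exists_tail_bound {w : ℂ} (hw : ∀ k : ℤ, w ≠ Real.pi + 2 * Real.pi * k) {R : ℝ}
    (hR : 0 < R) :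
    ∃ N : ℕ, ∃ M : ℝ, ∀ n : ℕ, N < n → ∀ ξ : ℂ, ‖ξ‖ < R →
      (∀ k : ℤ, ξ ≠ polePoint w n k) ∧ (∀ k : ℤ, ξ ≠ -polePoint w n k) ∧
      ‖term w ξ n‖ ≤ M / (n : ℝ) ^ 2 := by
  have hpi := Real.pi_pos
  have hw0 : 1 + exp (-I * w) ≠ 0 := by
    rw [Ne, one_add_exp_eq_zero_iff]; push Not; exact hw
  have hc1 : ContinuousAt (fun u : ℂ => 1 + exp (-I * u)) w := by fun_prop
  have hc2 : ContinuousAt (fun u : ℂ => ‖fermi u‖) w := by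
    unfold fermi
    exact (continuousAt_const.div hc1 hw0).norm
  obtain ⟨r, hr, hball⟩ := Metric.eventually_nhds_iff.1 ((hc1.eventually_ne hw0).and
    (hc2.eventually (Iio_mem_nhds (lt_add_one _))))
  obtain ⟨N, hN⟩ := exists_nat_gt (R / (Real.pi * r))
  refine ⟨N, 2 * (‖fermi w‖ + 1), fun n hn ξ hξ => ?_⟩
  have hn0 : n ≠ 0 := by omega
  have hnN : (N : ℝ) < n := by exact_mod_cast hn
  have hnpos : (0 : ℝ) < n := by exact_mod_cast Nat.pos_of_ne_zero hn0
  have hsmall : ‖((Real.pi : ℂ) * n)⁻¹ * ξ‖ < r := by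
    rw [norm_mul, norm_inv, norm_mul, norm_real, Real.norm_of_nonneg hpi.le, Complex.norm_natCast,
      inv_mul_lt_iff₀ (by positivity)]
    rw [div_lt_iff₀ (by positivity)] at hN
    nlinarith [mul_pos hpi hr]
  have hp := hball (y := w + I * (((Real.pi : ℂ) * n)⁻¹ * ξ)) (by
    rw [dist_eq_norm, add_sub_cancel_left, norm_mul, norm_I, one_mul]; exact hsmall)
  have hm := hball (y := w + I * (-((Real.pi : ℂ) * n)⁻¹ * ξ)) (by
    rw [dist_eq_norm, add_sub_cancel_left, norm_mul, norm_I, one_mul, neg_mul, norm_neg]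
    exact hsmall)
  refine ⟨?_, ?_, ?_⟩
  · have := hm.1; rw [Ne, exp_neg_iff_polePoint hn0] at this; push Not at this; exact this
  · have := hp.1; rw [Ne, exp_pos_iff_neg_polePoint hn0] at this; push Not at this; exact this
  · rw [term_eq_fermi, norm_mul, norm_div, norm_pow, norm_neg, norm_one, one_pow, norm_pow,
      Complex.norm_natCast, div_mul_eq_mul_div, one_mul]
    refine div_le_div_of_nonneg_right ((norm_add_le _ _).trans ?_) (by positivity)
    have h1 := hp.2
    have h2 := hm.2
    beta_reduce at h1 h2
    linarith

lemma summable_const_div_sq (M : ℝ) (N : ℕ) :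
    Summable fun n : ℕ => M / ((n + N + 1 : ℕ) : ℝ) ^ 2 := by
  have h := (Real.summable_one_div_nat_pow.2 (le_refl 2)).mul_left M
  simp only [mul_one_div] at h
  exact (summable_nat_add_iff (f := fun n : ℕ => M / (n : ℝ) ^ 2) (N + 1)).2 h

lemma summable_term {w : ℂ} (hw : ∀ k : ℤ, w ≠ Real.pi + 2 * Real.pi * k) (ξ : ℂ) :
    Summable fun n : ℕ => term w ξ (n + 1) := by
  obtain ⟨N, M, h⟩ := exists_tail_bound hw (R := ‖ξ‖ + 1) (by positivity)
  have h' : Summable fun n : ℕ => term w ξ (n + N + 1) :=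
    Summable.of_norm_bounded (summable_const_div_sq M N)
      fun n => (h _ (by omega) ξ (lt_add_one _)).2.2
  exact (summable_nat_add_iff (f := fun n : ℕ => term w ξ (n + 1)) N).1 h'

/-- The sum of the series, including the factor `2 / (iπ²)`. -/
def borelSum (w ξ : ℂ) : ℂ := 2 / (I * (Real.pi : ℂ) ^ 2) * ∑' n : ℕ, term w ξ (n + 1)

/-- Near any point the sum is a finite partial sum plus a holomorphic function, and only the
summands of the partial sum can have a pole there. -/
lemma exists_borelSum_eq {w : ℂ} (hw : ∀ k : ℤ, w ≠ Real.pi + 2 * Real.pi * k) (x : ℂ) :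
    ∃ N : ℕ, ∃ T : ℂ → ℂ, AnalyticAt ℂ T x ∧
      (∀ n : ℕ, N < n → ∀ k : ℤ, x ≠ polePoint w n k ∧ x ≠ -polePoint w n k) ∧
      ∀ᶠ ξ in 𝓝 x, borelSum w ξ =
        2 / (I * (Real.pi : ℂ) ^ 2) * (∑ n ∈ Finset.range N, term w ξ (n + 1) + T ξ) := by
  obtain ⟨N, M, h⟩ := exists_tail_bound hw (R := ‖x‖ + 1) (by positivity)
  have hx : x ∈ Metric.ball (0 : ℂ) (‖x‖ + 1) := by simp
  refine ⟨N, fun ξ => ∑' n : ℕ, term w ξ (n + N + 1), ?_, fun n hn k => ?_, ?_⟩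
  · have hs := summable_const_div_sq M N
    refine DifferentiableOn.analyticAt (s := Metric.ball (0 : ℂ) (‖x‖ + 1)) ?_
      (Metric.isOpen_ball.mem_nhds hx)
    refine differentiableOn_tsum_of_summable_norm hs (fun n ξ hξ => ?_) Metric.isOpen_ball
      fun n ξ hξ => (h _ (by omega) ξ (mem_ball_zero_iff.1 hξ)).2.2
    obtain ⟨h1, h2, -⟩ := h (n + N + 1) (by omega) ξ (mem_ball_zero_iff.1 hξ)
    exact (analyticAt_term (Nat.succ_ne_zero _) h1 h2).differentiableAt.differentiableWithinAt
  · obtain ⟨h1, h2, -⟩ := h n hn x (mem_ball_zero_iff.1 hx)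
    exact ⟨h1 k, h2 k⟩
  · refine Eventually.of_forall fun ξ => ?_
    rw [borelSum, ← (summable_term hw ξ).sum_add_tsum_nat_add N]

lemma polePoint_inj_right {w : ℂ} {n : ℕ} (hn : n ≠ 0) {k l : ℤ}
    (h : polePoint w n k = polePoint w n l) : k = l := by
  have hpi : (Real.pi : ℂ) ≠ 0 := by exact_mod_cast Real.pi_ne_zero
  have hn' : (n : ℂ) ≠ 0 := by exact_mod_cast hn
  have h1 := mul_left_cancel₀ (mul_ne_zero (mul_ne_zero I_ne_zero hpi) hn') h
  have h2 : 2 * (Real.pi : ℂ) * k = 2 * Real.pi * l := by linear_combination h1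
  exact_mod_cast mul_left_cancel₀ (mul_ne_zero two_ne_zero hpi) h2

open scoped Classical in
/-- For each `n` at most one `k` represents a given point, so the sums over representations are
sums over `n`. -/
lemma finsum_representations {v : ℕ → ℤ → ℂ} (hv : ∀ n, n ≠ 0 → Function.Injective (v n)) {x : ℂ}
    {N : ℕ} (hN : ∀ n, N < n → ∀ k, x ≠ v n k) :
    (∑ᶠ p ∈ {p : ℕ × ℤ | 1 ≤ p.1 ∧ x = v p.1 p.2}, (-1 : ℝ) ^ p.1 / (p.1 : ℝ)) =
      ∑ n ∈ Finset.range N,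
        if ∃ k, x = v (n + 1) k then (-1 : ℝ) ^ (n + 1) / ((n + 1 : ℕ) : ℝ) else 0 := by
  set S := {p : ℕ × ℤ | 1 ≤ p.1 ∧ x = v p.1 p.2} with hS
  have hinj : InjOn Prod.fst S := by
    rintro ⟨n, k⟩ ⟨h1, h2⟩ ⟨m, l⟩ ⟨h3, h4⟩ (rfl : n = m)
    have : k = l := hv n (by simpa using Nat.one_le_iff_ne_zero.1 h1) (h2.symm.trans h4)
    rw [this]
  have himg : Prod.fst '' S =
      (((Finset.range N).filter fun n => ∃ k, x = v (n + 1) k).image (· + 1) : Finset ℕ) := by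
    ext n
    simp only [mem_image, Finset.coe_image, Finset.coe_filter, Finset.mem_range]
    constructor
    · rintro ⟨⟨m, k⟩, ⟨h1, h2⟩, rfl⟩
      simp only at h1 h2 ⊢
      refine ⟨m - 1, ⟨?_, k, ?_⟩, by omega⟩
      · by_contra hcon
        exact hN m (by omega) k h2
      · rwa [Nat.sub_add_cancel h1]
    · rintro ⟨m, ⟨-, k, hk⟩, rfl⟩
      exact ⟨(m + 1, k), ⟨by simp, hk⟩, rfl⟩
  rw [← finsum_mem_image (f := fun n : ℕ => (-1 : ℝ) ^ n / (n : ℝ)) hinj, himg,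
    finsum_mem_coe_finset, Finset.sum_image fun a _ b _ h => by simpa using h, Finset.sum_filter]

theorem hasSimplePart_borelSum {w : ℂ} (hw : ∀ k : ℤ, w ≠ Real.pi + 2 * Real.pi * k) (x : ℂ) :
    HasSimplePart (borelSum w) x
      (2 / (I * (Real.pi : ℂ) ^ 2) * (Real.pi * (poleWeight w x : ℂ))) := by
  classical
  obtain ⟨N, T, hT, hN, hev⟩ := exists_borelSum_eq hw x
  have h := ((HasSimplePart.sum (Finset.range N) fun n _ =>
    hasSimplePart_term w x (Nat.succ_ne_zero n)).add (.of_analyticAt hT)).const_mul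
      (2 / (I * (Real.pi : ℂ) ^ 2))
  have h' := h.congr hev
  convert h' using 2
  rw [add_zero, ← Finset.mul_sum, Finset.sum_sub_distrib, poleWeight,
    finsum_representations (v := polePoint w) (fun n hn k l h => polePoint_inj_right hn h)
      fun n hn k => (hN n hn k).1,
    finsum_representations (v := fun n k => -polePoint w n k)
      (fun n hn k l h => polePoint_inj_right hn (neg_inj.1 h)) fun n hn k => (hN n hn k).2]
  push_cast
  congr 2 <;> refine Finset.sum_congr rfl fun n _ => ?_ <;> split_ifs <;> push_cast <;> rfl

theorem analyticAt_borelSum {w : ℂ} (hw : ∀ k : ℤ, w ≠ Real.pi + 2 * Real.pi * k) {x : ℂ}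
    (hx : x ∉ poleSet w) : AnalyticAt ℂ (borelSum w) x := by
  obtain ⟨N, T, hT, -, hev⟩ := exists_borelSum_eq hw x
  refine AnalyticAt.congr (analyticAt_const.mul (AnalyticAt.add ?_ hT)) (hev.mono fun _ h => h.symm)
  refine Finset.analyticAt_fun_sum _ fun n _ => analyticAt_term (Nat.succ_ne_zero n) ?_ ?_
  · exact fun k hk => hx ⟨n + 1, by omega, k, Or.inl hk⟩
  · exact fun k hk => hx ⟨n + 1, by omega, k, Or.inr hk⟩

lemma meromorphicOrderAt_borelSum_neg_iff {w : ℂ} (hw : ∀ k : ℤ, w ≠ Real.pi + 2 * Real.pi * k)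
    (x : ℂ) : meromorphicOrderAt (borelSum w) x < 0 ↔ poleWeight w x ≠ 0 := by
  have hpi : (Real.pi : ℂ) ≠ 0 := by exact_mod_cast Real.pi_ne_zero
  rw [(hasSimplePart_borelSum hw x).meromorphicOrderAt_neg_iff]
  simp [hpi]

lemma poleWeight_neg (w x : ℂ) : poleWeight w (-x) = -poleWeight w x := by
  simp only [poleWeight, neg_eq_iff_eq_neg, neg_neg]
  ring

/-! ### Irrational `w / π` -/

lemma eq_pi_mul_rat {w : ℂ} {m : ℤ} (hm : m ≠ 0) {l : ℤ} (h : w * m = Real.pi * l) :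
    ∃ q : ℚ, w = Real.pi * q := by
  have hm' : (m : ℂ) ≠ 0 := by exact_mod_cast hm
  refine ⟨l / m, ?_⟩
  push_cast
  rw [← mul_div_assoc, eq_div_iff hm', h]

/-- If `w / π` is irrational, every point of `poleSet w` has a single representation. -/
lemma poleWeight_ne_zero_of_irrational {w : ℂ} (hw : ∀ q : ℚ, w ≠ Real.pi * q) {x : ℂ}
    (hx : x ∈ poleSet w) : poleWeight w x ≠ 0 := by
  have hpi : (Real.pi : ℂ) ≠ 0 := by exact_mod_cast Real.pi_ne_zero
  -- two representations of one point, of equal or opposite sign, make `w / π` rational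
  have key : ∀ n : ℕ, 1 ≤ n → ∀ k : ℤ, poleWeight w (polePoint w n k) ≠ 0 := by
    intro n hn k
    have h1 : {p : ℕ × ℤ | 1 ≤ p.1 ∧ polePoint w n k = polePoint w p.1 p.2} = {(n, k)} := by
      ext ⟨m, l⟩
      simp only [mem_ofPred_eq, mem_singleton_iff, Prod.mk.injEq]
      constructor
      · rintro ⟨hm, h⟩
        by_cases hmn : m = n
        · subst hmn
          exact ⟨rfl, (polePoint_inj_right (by omega) h).symm⟩
        · exfalso
          have h2 : (I * Real.pi : ℂ) * (w * ((n : ℤ) - (m : ℤ) : ℤ)) =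
              I * Real.pi * (Real.pi * (n * (1 + 2 * k) - m * (1 + 2 * l) : ℤ)) := by
            rw [polePoint, polePoint] at h
            push_cast
            linear_combination -h
          obtain ⟨q, hq⟩ := eq_pi_mul_rat (by omega)
            (mul_left_cancel₀ (mul_ne_zero I_ne_zero hpi) h2)
          exact hw q hq
      · rintro ⟨rfl, rfl⟩
        exact ⟨hn, rfl⟩
    have h2 : {p : ℕ × ℤ | 1 ≤ p.1 ∧ polePoint w n k = -polePoint w p.1 p.2} = ∅ := by
      refine eq_empty_of_forall_notMem ?_
      rintro ⟨m, l⟩ ⟨hm, h⟩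
      have h2 : (I * Real.pi : ℂ) * (w * ((n : ℤ) + (m : ℤ) : ℤ)) =
          I * Real.pi * (Real.pi * (n * (1 + 2 * k) + m * (1 + 2 * l) : ℤ)) := by
        rw [polePoint, polePoint] at h
        push_cast
        linear_combination -h
      obtain ⟨q, hq⟩ := eq_pi_mul_rat (by simp only at hm; omega)
        (mul_left_cancel₀ (mul_ne_zero I_ne_zero hpi) h2)
      exact hw q hq
    rw [poleWeight, h1, h2, finsum_mem_singleton, finsum_mem_empty, sub_zero]
    have : (n : ℝ) ≠ 0 := by exact_mod_cast (by omega : n ≠ 0)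
    exact div_ne_zero (pow_ne_zero _ (by norm_num)) this
  obtain ⟨n, hn, k, rfl | rfl⟩ := hx
  · exact key n hn k
  · rw [poleWeight_neg]
    exact neg_ne_zero.2 (key n hn k)

/-! ### The strip, and the Borel transform -/

lemma ne_pole_of_mem_W {θ δ : ℝ} (hδ : 0 < δ) (hc : 0 < Real.cos θ) {w : ℂ} (hw : w ∈ W θ δ)
    (k : ℤ) : w ≠ Real.pi + 2 * Real.pi * k := by
  have := not_pole_of_mem_W hδ hc hw (s := 0) (k := k)
  simpa using this

lemma disjoint_halfLine_poleSet {θ δ : ℝ} (hδ : 0 < δ) (hc : 0 < Real.cos θ) {w : ℂ}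
    (hw : w ∈ W θ δ) : Disjoint (halfLine (-θ)) (poleSet w) := by
  have hpi : (Real.pi : ℂ) ≠ 0 := by exact_mod_cast Real.pi_ne_zero
  rw [Set.disjoint_left]
  rintro ξ ⟨s, -, hs⟩ ⟨n, hn, k, hk⟩
  have hn' : (n : ℂ) ≠ 0 := by exact_mod_cast (by omega : n ≠ 0)
  rw [ofReal_neg] at hs
  rcases hk with hk | hk
  · refine not_pole_of_mem_W hδ hc hw (s := s / (Real.pi * n)) (k := k) ?_
    rw [hs, polePoint] at hk
    push_cast
    rw [div_mul_eq_mul_div, ← sub_eq_iff_eq_add', eq_div_iff (mul_ne_zero hpi hn')]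
    linear_combination (-I) * hk - Real.pi * n * (Real.pi - w + 2 * Real.pi * k) * I_sq
  · refine not_pole_of_mem_W hδ hc hw (s := -s / (Real.pi * n)) (k := k) ?_
    rw [hs, polePoint] at hk
    push_cast
    rw [div_mul_eq_mul_div, ← sub_eq_iff_eq_add', eq_div_iff (mul_ne_zero hpi hn')]
    linear_combination I * hk - Real.pi * n * (Real.pi - w + 2 * Real.pi * k) * I_sq

theorem isBorelTransformOn_borelSum {θ δ ε : ℝ} (hδ : 0 < δ) (hε : ε ∈ Ioo 0 (Real.cos θ))
    {w : ℂ} (hw : w ∈ W θ δ) {V : Set ℂ} (hV : Disjoint V (poleSet w)) :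
    IsBorelTransformOn θ ε w V (borelSum w) := by
  refine ⟨fun ξ hξ => analyticAt_borelSum (ne_pole_of_mem_W hδ (hε.1.trans hε.2) hw)
    (Set.disjoint_left.1 hV hξ), ?_⟩
  filter_upwards [Metric.ball_mem_nhds (0 : ℂ) (half_pos hδ)] with ξ hξ
  exact hasSum_borel_gPlus hδ hε hw (mem_ball_zero_iff.1 hξ)

lemma zero_mem_halfLine (α : ℝ) : (0 : ℂ) ∈ halfLine α := ⟨0, le_rfl, by simp⟩

end Faddeev

end

theorem mainTheorem6 :
    (∀ θ ∈ Set.Ioo (-(Real.pi / 2)) (Real.pi / 2),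
      ∀ δ ∈ Set.Ioo 0 (Real.pi * Real.cos θ), ∀ ε ∈ Set.Ioo 0 (Real.cos θ),
      ∀ w ∈ Faddeev.W θ δ,
        (∀ m : ℕ, 1 ≤ m → Integrable (Faddeev.hIntegrand θ ε w m)) ∧
        Disjoint (Faddeev.halfLine (-θ)) (Faddeev.poleSet w) ∧
        ∀ V : Set ℂ, IsOpen V → IsPreconnected V → Faddeev.halfLine (-θ) ⊆ V →
          Disjoint V (Faddeev.poleSet w) →
          (∃ B : ℂ → ℂ, Faddeev.IsBorelTransformOn θ ε w V B) ∧
          ∀ B : ℂ → ℂ, Faddeev.IsBorelTransformOn θ ε w V B → ∀ ξ ∈ V,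
            Summable (fun n : ℕ => Faddeev.term w ξ (n + 1)) ∧
            B ξ = 2 / (I * (Real.pi : ℂ) ^ 2) * ∑' n : ℕ, Faddeev.term w ξ (n + 1)) ∧
    (∀ w : ℂ, (∀ k : ℤ, w ≠ Real.pi + 2 * Real.pi * k) →
      ∃ F : ℂ → ℂ, MeromorphicOn F Set.univ ∧
        (∀ ξ ∉ Faddeev.poleSet w, AnalyticAt ℂ F ξ ∧
          Summable (fun n : ℕ => Faddeev.term w ξ (n + 1)) ∧
          F ξ = 2 / (I * (Real.pi : ℂ) ^ 2) * ∑' n : ℕ, Faddeev.term w ξ (n + 1)) ∧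
        (∀ θ ∈ Set.Ioo (-(Real.pi / 2)) (Real.pi / 2),
          ∀ δ ∈ Set.Ioo 0 (Real.pi * Real.cos θ), ∀ ε ∈ Set.Ioo 0 (Real.cos θ),
          w ∈ Faddeev.W θ δ → Faddeev.IsBorelTransformOn θ ε w (Faddeev.poleSet w)ᶜ F) ∧
        {ξ : ℂ | meromorphicOrderAt F ξ < 0} =
          {ξ ∈ Faddeev.poleSet w | Faddeev.poleWeight w ξ ≠ 0} ∧
        ((∀ q : ℚ, w ≠ Real.pi * q) →
          {ξ : ℂ | meromorphicOrderAt F ξ < 0} = Faddeev.poleSet w)) := by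
  refine ⟨fun θ _ δ hδ ε hε w hw => ?_, fun w hw => ?_⟩
  · have hc : 0 < Real.cos θ := hε.1.trans hε.2
    have hne := Faddeev.ne_pole_of_mem_W hδ.1 hc hw
    refine ⟨fun m hm => Faddeev.integrable_hIntegrand hδ.1 hε hw hm,
      Faddeev.disjoint_halfLine_poleSet hδ.1 hc hw, fun V _ hVc hV hVP => ?_⟩
    have hF := Faddeev.isBorelTransformOn_borelSum hδ.1 hε hw hVP
    refine ⟨⟨_, hF⟩, fun B hB ξ hξ => ⟨Faddeev.summable_term hne ξ, ?_⟩⟩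
    have hev : B =ᶠ[𝓝 0] Faddeev.borelSum w := by
      filter_upwards [hB.2, hF.2] with z h1 h2
      exact h1.unique h2
    exact hB.1.eqOn_of_preconnected_of_eventuallyEq hF.1 hVc
      (hV (Faddeev.zero_mem_halfLine _)) hev hξ
  · have hpoles : {ξ : ℂ | meromorphicOrderAt (Faddeev.borelSum w) ξ < 0} =
        {ξ ∈ Faddeev.poleSet w | Faddeev.poleWeight w ξ ≠ 0} := by
      ext ξ
      rw [mem_ofPred_eq, mem_ofPred_eq, ← Faddeev.meromorphicOrderAt_borelSum_neg_iff hw,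
        iff_and_self]
      intro h
      by_contra hξ
      exact not_le.2 h (Faddeev.analyticAt_borelSum hw hξ).meromorphicOrderAt_nonneg
    refine ⟨Faddeev.borelSum w, fun ξ _ => (Faddeev.hasSimplePart_borelSum hw ξ).meromorphicAt,
      fun ξ hξ => ⟨Faddeev.analyticAt_borelSum hw hξ, Faddeev.summable_term hw ξ, rfl⟩,
      fun θ _ δ hδ ε hε hwW => Faddeev.isBorelTransformOn_borelSum hδ.1 hε hwW
        disjoint_compl_left, hpoles, fun hirr => ?_⟩
    rw [hpoles]
    exact Set.sep_eq_self_iff_mem_true.2 fun ξ hξ =>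
      Faddeev.poleWeight_ne_zero_of_irrational hirr hξ
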